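/- Let $k=\mathbb F_q$ be a finite field. Let $\pi:X\to C$ be a ruled surface over $k$: $C$ is a smooth projective geometrically integral curve over $k$, $X$ is a smooth projective geometrically integral surface over $k$, $\pi$ is a $k$-morphism whose fibre over every closed point $y\in C$ is isomorphic to $\mathbb P^1_{\kappa(y)}$ over $\kappa(y)$, and $\pi$ has a section $\sigma:C\to X$ with image $C_0$. Assume that it is normalized, i.e. for the rank-2 bundle $\mathcal E=\pi_*\mathcal O_X(C_0)$ (so that $X\cong\mathbb P(\mathcal E)$) one has $H^0(C,\mathcal E)\neq 0$, and $H^0(C,\mathcal E\otimes\mathcal O_C(\mathfrak b))=H^0(X,\mathcal O_X(C_0+\pi^*\mathfrak b))=0$ for every divisor $\mathfrak b$ on $C$ with $\deg\mathfrak b<0$; and assume that its invariant $e=-C_0^2$ satisfies $e\ge 0$. Put $a=\#C(\mathbb F_q)$, let $\mathcal S=X(\mathbb F_q)$ be the set of all rational points of $X$, and $n=\#\mathcal S$. Let $b_1,b_2\in\mathbb Z$, let $\mathfrak b$ be a divisor of degree $b_2$ on $C$ defined over $\mathbb F_q$ (for instance $b_2$ times a rational point, in which case $\pi^*\mathfrak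 b=b_2f$ for a fibre $f$ of $\pi$), and let $\mathcal L=\mathcal O_X(b_1C_0+\pi^*\mathfrak b)$. For any choice of local trivializations of $\mathcal L$ at the points of $\mathcal S$, let $C(X,\mathcal L;\mathcal S)\subseteq\mathbb F_q^{\,n}$ be the image of the map $\Gamma(X,\mathcal L)\to\bigoplus_{P\in\mathcal S}\mathcal L_P/\mathfrak m_P\mathcal L_P\cong\mathbb F_q^{\,n}$. If $$b_2<a\qquad\text{and}\qquad n-b_2(q+1)-(a-b_2)b_1>0,$$ then $a$ and $n$ are finite and $n=a(q+1)$, the divisor $b_1C_0+\pi^*\mathfrak b$ is locally principal (so $\mathcal L$ is a line bundle), $\Gamma(X,\mathcal L)$ is finite-dimensional over $\mathbb F_q$, and the code $C(X,\mathcal L;\mathcal S)$ has length $n=a(q+1)$, dimension $\dim_{\mathbb F_q}\Gamma(X,\mathcal L)$, and minimum distance $$d\ \ge\ n-b_2(q+1)-(a-b_2)b_1$$ (a code with only the zero codeword is given $d=\infty$). -/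

import Mathlib

open CategoryTheory AlgebraicGeometry

universe u

noncomputable section

namespace RuledCode

/-! ### Schemes over a field: scalars, rational points, closed points, the projective line -/

section Basics

variable {k : Type u} [Field k] {X : Scheme.{u}}

/-- The scalars `k → 𝒪_{X,x}` of the local ring at `x` of a scheme `s : X ⟶ Spec k`. -/
def scalarHom (s : X ⟶ Spec (.of k)) (x : X) : k →+* X.presheaf.stalk x :=
  ((Scheme.ΓSpecIso (.of k)).inv ≫ s.appTop ≫ X.presheaf.germ ⊤ x (TopologicalSpace.Opens.mem_top x)).hom

/-- The scalars `k → κ(x)` of the residue field at `x`. -/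
def residueScalarHom (s : X ⟶ Spec (.of k)) (x : X) : k →+* X.residueField x :=
  (X.residue x).hom.comp (scalarHom s x)

/-- The `k`-rational points `X(k)`: the points with residue field `k`. -/
def RationalPoint (s : X ⟶ Spec (.of k)) : Type u :=
  {x : X // Function.Bijective (residueScalarHom s x)}

/-- The value in `k` of a germ at a rational point. -/
def value (s : X ⟶ Spec (.of k)) (P : RationalPoint s) : X.presheaf.stalk P.1 →+* k :=
  (RingEquiv.ofBijective _ P.2).symm.toRingHom.comp (X.residue P.1).hom

theorem value_scalarHom (s : X ⟶ Spec (.of k)) (P : RationalPoint s) (c : k) :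
    value s P (scalarHom s P.1 c) = c :=
  (RingEquiv.ofBijective _ P.2).symm_apply_apply c

/-- Closed points of a scheme. -/
def ClosedPoint (X : Scheme.{u}) : Type u := {x : X // IsClosed ({x} : Set X)}

/-- Divisors on a curve: finite formal `ℤ`-combinations of closed points. -/
abbrev CurveDivisor (C : Scheme.{u}) : Type u := ClosedPoint C →₀ ℤ

open Classical in
/-- The multiplicity of a divisor at a point of the scheme (`0` at a non-closed point). -/
def coeff {C : Scheme.{u}} (𝔟 : CurveDivisor C) (y : C) : ℤ :=
  if h : IsClosed ({y} : Set C) then 𝔟 ⟨y, h⟩ else 0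

/-- The degree `∑ 𝔟(p) [κ(p) : k]` of a divisor on a curve over `k`. -/
def degree {C : Scheme.{u}} (s : C ⟶ Spec (.of k)) (𝔟 : CurveDivisor C) : ℤ :=
  𝔟.sum fun p n => n * (s.residueDegree p.1 : ℤ)

/-- The projective line `Proj K[x₀, x₁]` as a scheme over `Spec K`. -/
def projLine (K : Type u) [Field K] : Over (Spec (.of K)) :=
  letI : GradedAlgebra (MvPolynomial.homogeneousSubmodule (Fin 2) K) := MvPolynomial.gradedAlgebra
  Over.mk (Proj.toSpecZero (MvPolynomial.homogeneousSubmodule (Fin 2) K) ≫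
    Spec.map (CommRingCat.ofHom
      (algebraMap K (MvPolynomial.homogeneousSubmodule (Fin 2) K 0))))

end Basics

/-! ### Ruled surfaces -/

/-- A ruled surface `π : X ⟶ C` over `k`, with a chosen section `σ`: `C` is a smooth complete
geometrically integral curve, `X` a smooth complete geometrically integral surface, and the
fibre of `π` over every closed point `y` of `C` is the projective line over `κ(y)`.
(Smooth complete curves and surfaces are projective.) -/
structure RuledSurface (k : Type u) [Field k] where
  X : Scheme.{u}
  C : Scheme.{u}
  strX : X ⟶ Spec (.of k)
  strC : C ⟶ Spec (.of k)
  π : X ⟶ C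
  σ : C ⟶ X
  π_over : π ≫ strC = strX
  σ_π : σ ≫ π = 𝟙 C
  integralX : IsIntegral X
  integralC : IsIntegral C
  geomIntegralX : GeometricallyIntegral strX
  geomIntegralC : GeometricallyIntegral strC
  properX : IsProper strX
  properC : IsProper strC
  smoothX : SmoothOfRelativeDimension 2 strX
  smoothC : SmoothOfRelativeDimension 1 strC
  fiber_projLine : ∀ y : C, IsClosed ({y} : Set C) →
    Nonempty (Over.mk (π.fiberToSpecResidueField y) ≅ projLine (C.residueField y))

namespace RuledSurface

variable {k : Type u} [Field k] (R : RuledSurface k)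

instance : IsIntegral R.X := R.integralX

instance : IsIntegral R.C := R.integralC

/-- Local rings, and in particular the function field, of `X` are `k`-algebras. -/
instance (x : R.X) : Algebra k (R.X.presheaf.stalk x) := (scalarHom R.strX x).toAlgebra

/-- The stalk at `x` of the ideal sheaf `ker (𝒪_X → σ_* 𝒪_C)` of the curve `C₀ = σ(C)`:
germs of the sections of `𝒪_X` near `x` that vanish on `C₀`. -/
def idealC₀ (x : R.X) : Ideal (R.X.presheaf.stalk x) :=
  Ideal.span {u | ∃ (U : R.X.Opens) (hx : x ∈ U) (a : Γ(R.X, U)),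
    R.σ.app U a = 0 ∧ R.X.presheaf.germ U x hx a = u}

/-- `t ∈ K(C)` is a local equation of the divisor `𝔡` at the point `y` of `C`:
`t = w ϖ ^ 𝔡(y)` with `w` a unit and `ϖ` a generator of the maximal ideal of `𝒪_{C,y}`. -/
def IsCurveEquation (𝔡 : CurveDivisor R.C) (y : R.C) (t : R.C.functionField) : Prop :=
  ∃ (w : (R.C.presheaf.stalk y)ˣ) (ϖ : R.C.presheaf.stalk y),
    Ideal.span {ϖ} = IsLocalRing.maximalIdeal (R.C.presheaf.stalk y) ∧
    t = algebraMap (R.C.presheaf.stalk y) R.C.functionField w *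
      algebraMap (R.C.presheaf.stalk y) R.C.functionField ϖ ^ coeff 𝔡 y

/-- `t ∈ K(X)` is a local equation at `x` of the divisor `D = b₁ C₀ + π^*𝔟`:
`t = w g ^ b₁ (π^*ϖ) ^ 𝔟(π x)` with `w` a unit of `𝒪_{X,x}`, `g` a local equation of `C₀` at `x`
and `ϖ` a generator of the maximal ideal of `𝒪_{C,π x}`. -/
def IsLocalEquation (b₁ : ℤ) (𝔟 : CurveDivisor R.C) (x : R.X) (t : R.X.functionField) : Prop :=
  ∃ (w : (R.X.presheaf.stalk x)ˣ) (g : R.X.presheaf.stalk x)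
    (ϖ : R.C.presheaf.stalk (R.π x)),
    Ideal.span {g} = R.idealC₀ x ∧
    Ideal.span {ϖ} = IsLocalRing.maximalIdeal (R.C.presheaf.stalk (R.π x)) ∧
    t = algebraMap (R.X.presheaf.stalk x) R.X.functionField w *
      algebraMap (R.X.presheaf.stalk x) R.X.functionField g ^ b₁ *
      algebraMap (R.X.presheaf.stalk x) R.X.functionField (R.π.stalkMap x ϖ) ^ coeff 𝔟 (R.π x)

theorem algebraMap_scalar (x : R.X) (c : k) :
    algebraMap (R.X.presheaf.stalk x) R.X.functionField (scalarHom R.strX x c) =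
      algebraMap k R.X.functionField c := by
  have h := R.X.presheaf.germ_stalkSpecializes (U := ⊤) (TopologicalSpace.Opens.mem_top x)
    ((genericPoint_spec R.X).specializes trivial)
  exact congrArg (fun φ => φ.hom (R.strX.appTop ((Scheme.ΓSpecIso (.of k)).inv c))) h

/-- The space of global sections `Γ(X, 𝒪_X(b₁ C₀ + π^*𝔟))`, where `𝒪_X(D)` is the
subsheaf of the constant sheaf `K(X)` whose stalk at `x` is `t⁻¹ 𝒪_{X,x}`, for `t` a local
equation of `D` at `x`. -/
def sections (b₁ : ℤ) (𝔟 : CurveDivisor R.C) : Submodule k R.X.functionField where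
  carrier := {f | ∀ (x : R.X) (t : R.X.functionField), R.IsLocalEquation b₁ 𝔟 x t →
    ∃ u : R.X.presheaf.stalk x, algebraMap (R.X.presheaf.stalk x) R.X.functionField u = f * t}
  zero_mem' := fun x t _ => ⟨0, by simp⟩
  add_mem' := fun {f g} hf hg x t ht => by
    obtain ⟨u, hu⟩ := hf x t ht
    obtain ⟨v, hv⟩ := hg x t ht
    exact ⟨u + v, by rw [map_add, hu, hv, add_mul]⟩
  smul_mem' := fun c f hf x t ht => by
    obtain ⟨u, hu⟩ := hf x t ht
    exact ⟨scalarHom R.strX x c * u, by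
      rw [map_mul, hu, algebraMap_scalar, Algebra.smul_def, mul_assoc]⟩

/-- The section `C₀` is normalized: for `ℰ = π_* 𝒪_X(C₀)`, the rank `2` bundle on `C` with
`X = ℙ(ℰ)` and `𝒪_{ℙ(ℰ)}(1) = 𝒪_X(C₀)`, one has `H⁰(C, ℰ) ≠ 0`, and `H⁰(C, ℰ ⊗ 𝒪_C(𝔟)) = 0` for
every `𝔟` of negative degree.  Here `H⁰(C, ℰ ⊗ 𝒪_C(𝔟)) = Γ(X, 𝒪_X(C₀ + π^*𝔟))`. -/
def IsNormalized : Prop :=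
  R.sections 1 0 ≠ ⊥ ∧ ∀ 𝔟 : CurveDivisor R.C, degree R.strC 𝔟 < 0 → R.sections 1 𝔟 = ⊥

/-- `C₀² = m`, that is `deg σ^*𝒪_X(C₀) = m`: for some `r ∈ K(X)` the divisor `C₀ + div r` does not
contain `C₀`, and pulls back under `σ` to a divisor `𝔡` of degree `m` on `C`.  At a closed point
`p`, with `g` a local equation of `C₀` at `σ p`, this means that `r g = u / v` with `u`, `v` in
the local ring of `X` at `σ p` not vanishing on `C₀`, and that `σ^*u / σ^*v` is a local
equation of `𝔡` at `p`. -/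
def SelfIntersection (m : ℤ) : Prop :=
  ∃ (r : R.X.functionField) (𝔡 : CurveDivisor R.C), degree R.strC 𝔡 = m ∧
    ∀ p : R.C, IsClosed ({p} : Set R.C) →
      ∃ g u v : R.X.presheaf.stalk (R.σ p),
        Ideal.span {g} = R.idealC₀ (R.σ p) ∧
        r * algebraMap (R.X.presheaf.stalk (R.σ p)) R.X.functionField g *
          algebraMap (R.X.presheaf.stalk (R.σ p)) R.X.functionField v =
          algebraMap (R.X.presheaf.stalk (R.σ p)) R.X.functionField u ∧
        R.σ.stalkMap p u ≠ 0 ∧ R.σ.stalkMap p v ≠ 0 ∧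
        R.IsCurveEquation 𝔡 p
          (algebraMap (R.C.presheaf.stalk p) R.C.functionField (R.σ.stalkMap p u) /
            algebraMap (R.C.presheaf.stalk p) R.C.functionField (R.σ.stalkMap p v))

/-- The invariant of the normalized ruled surface is `e = -C₀²`. -/
def HasInvariant (e : ℤ) : Prop := R.SelfIntersection (-e)

/-! ### The code -/

/-- A choice of a local trivialization of `ℒ = 𝒪_X(b₁ C₀ + π^*𝔟)` at each rational point `P` of `X`:
multiplication by a local equation `t P` maps `ℒ_P = (t P)⁻¹ 𝒪_{X,P}` isomorphically onto
`𝒪_{X,P}`. -/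
structure Trivialization (b₁ : ℤ) (𝔟 : CurveDivisor R.C) where
  t : RationalPoint R.strX → R.X.functionField
  isLocalEquation : ∀ P, R.IsLocalEquation b₁ 𝔟 P.1 (t P)

variable {R}

/-- The germ at `P` of a global section of `ℒ`, as an element of `𝒪_{X,P}` through the chosen
trivialization. -/
def Trivialization.germ {b₁ : ℤ} {𝔟 : CurveDivisor R.C} (τ : R.Trivialization b₁ 𝔟)
    (P : RationalPoint R.strX) (f : R.sections b₁ 𝔟) : R.X.presheaf.stalk P.1 :=
  (f.2 P.1 (τ.t P) (τ.isLocalEquation P)).choose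

theorem Trivialization.algebraMap_germ {b₁ : ℤ} {𝔟 : CurveDivisor R.C}
    (τ : R.Trivialization b₁ 𝔟) (P : RationalPoint R.strX) (f : R.sections b₁ 𝔟) :
    algebraMap (R.X.presheaf.stalk P.1) R.X.functionField (τ.germ P f) = f.1 * τ.t P :=
  (f.2 P.1 (τ.t P) (τ.isLocalEquation P)).choose_spec

/-- The germ map `α : Γ(X, ℒ) → ⨁_P ℒ_P / 𝔪_P ℒ_P ≃ k ^ n`, over all rational points `P` of `X`. -/
def Trivialization.germMap {b₁ : ℤ} {𝔟 : CurveDivisor R.C} (τ : R.Trivialization b₁ 𝔟) :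
    R.sections b₁ 𝔟 →ₗ[k] (RationalPoint R.strX → k) where
  toFun f P := value R.strX P (τ.germ P f)
  map_add' f g := by
    funext P
    have h : τ.germ P (f + g) = τ.germ P f + τ.germ P g := by
      apply IsFractionRing.injective (R.X.presheaf.stalk P.1) R.X.functionField
      rw [map_add]
      simp only [τ.algebraMap_germ]
      exact add_mul _ _ _
    simp [h]
  map_smul' c f := by
    funext P
    have h : τ.germ P (c • f) = scalarHom R.strX P.1 c * τ.germ P f := by
      apply IsFractionRing.injective (R.X.presheaf.stalk P.1) R.X.functionField
      rw [map_mul, algebraMap_scalar]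
      simp only [τ.algebraMap_germ]
      rw [← mul_assoc, ← Algebra.smul_def]
      rfl
    simp [h, value_scalarHom]

/-- The code `C(X, ℒ; X(k))`: the image of the germ map. -/
def Trivialization.code {b₁ : ℤ} {𝔟 : CurveDivisor R.C} (τ : R.Trivialization b₁ 𝔟) :
    Submodule k (RationalPoint R.strX → k) :=
  LinearMap.range τ.germMap

end RuledSurface

/-- The minimum distance of a code: the least number of positions in which two distinct
codewords differ (`⊤` if there is only one codeword). -/
def minDist {ι k : Type*} [Field k] (E : Submodule k (ι → k)) : ℕ∞ :=
  ⨅ (c ∈ E) (c' ∈ E) (_ : c ≠ c'), {i | c i ≠ c' i}.encard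

end RuledCode

end

/-! Let `f` be a nonzero section of `𝒪_X(b₁C₀ + π^*𝔟)`. Rational points of `X` lie over rational
points of `C`, and each of the `a` fibres concerned is a projective line over `k` with `q + 1`
rational points, so `n = a(q + 1)`. Zeros of `f` are counted fibre by fibre. Let `T` be the set of
rational points of `C` along whose fibres `f` vanishes identically. On any other fibre `f` restricts
to a nonzero section of `𝒪(b₁)`, because `C₀` meets the fibre in one reduced point; it has at most
`b₁` zeros there, and `b₁ ≥ 0`. The number of zeros is therefore at most `|T|(q + 1) + (a - |T|)b₁`.
The positivity hypothesis reads `(a - b₂)(q + 1 - b₁) > 0`, so `b₁ < q + 1`, the bound increases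
with `|T|`, and it remains to see that `|T| ≤ b₂`.

Dividing out the fibres over `T` makes `f` a section of `𝒪_X(b₁C₀ + π^*(𝔟 - T))`, so the needed
statement is: a divisor `bC₀ + π^*𝔟` with a nonzero section has `deg 𝔟 ≥ 0`
(`IsNormalized.degree_nonneg_of_mem_sections`). Remove `C₀` as often as possible, leaving `cC₀ +
π^*𝔟` with `c ≥ 0`, again by restriction to a fibre. Now `f` does not vanish along `C₀`, and its
restriction is a nonzero section of a line bundle on `C` of degree `deg 𝔟 - ce`. Degrees of line
bundles on `C` with nonzero sections are nonnegative by normalization itself: a function `φ` with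
poles bounded by `𝔠` pulls back to a section of `𝒪_X(C₀ + π^*𝔠)`, which is zero if `deg 𝔠 < 0`
(`IsNormalized.degree_nonneg`). Since `e ≥ 0`, it follows that `deg 𝔟 ≥ ce ≥ 0`.

The geometry is carried by local rings. The fibre bound is `ProjLineCharts.zeros_le`, a count of
roots of a polynomial, moved to `X` by `encard_fiber_zeros_le`. The transfer rests on
`fiberι_stalkMap_ker` (a germ vanishing on a fibre is divisible by the uniformizer of the base) and
on `exists_span_eq_idealC₀` (`C₀` is locally principal, by Nakayama). -/

noncomputable section

namespace RuledCode

/-! ### The standard charts of the projective line -/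

section ProjRing

open HomogeneousLocalization

variable (K : Type u) [Field K]

/-- The grading of `K[x₀, x₁]` by degree. -/
abbrev lineGrading : ℕ → Submodule K (MvPolynomial (Fin 2) K) :=
  MvPolynomial.homogeneousSubmodule (Fin 2) K

instance : GradedAlgebra (lineGrading K) := MvPolynomial.gradedAlgebra

theorem X_mem_lineGrading (i : Fin 2) : (MvPolynomial.X i : MvPolynomial (Fin 2) K) ∈ lineGrading K 1 :=
  MvPolynomial.isHomogeneous_X K i

/-- The coordinate `xⱼ / xᵢ` on the chart `xᵢ ≠ 0`. -/
def awayCoord (i j : Fin 2) : Away (lineGrading K) (MvPolynomial.X i : MvPolynomial (Fin 2) K) :=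
  Away.mk (lineGrading K) (X_mem_lineGrading K i) 1 (MvPolynomial.X j)
    (by simpa using X_mem_lineGrading K j)

/-- The constants in the coordinate ring of the chart `xᵢ ≠ 0`. -/
def awayScalar (i : Fin 2) :
    K →+* Away (lineGrading K) (MvPolynomial.X i : MvPolynomial (Fin 2) K) :=
  (fromZeroRingHom (lineGrading K) _).comp (algebraMap K (lineGrading K 0))

theorem val_awayScalar (i : Fin 2) (c : K) : (awayScalar K i c).val =
    algebraMap (MvPolynomial (Fin 2) K) _ (MvPolynomial.C c) := by
  simp only [awayScalar, RingHom.comp_apply, fromZeroRingHom]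
  change Localization.mk _ _ = _
  rw [← Localization.mk_one_eq_algebraMap]
  rfl

theorem val_awayCoord_mul (i j : Fin 2) :
    (awayCoord K i j).val * algebraMap (MvPolynomial (Fin 2) K) _ (MvPolynomial.X i) =
      algebraMap (MvPolynomial (Fin 2) K) _ (MvPolynomial.X j) := by
  have h := IsLocalization.mk'_spec
    (Localization.Away (MvPolynomial.X i : MvPolynomial (Fin 2) K))
    (MvPolynomial.X j : MvPolynomial (Fin 2) K)
    (⟨(MvPolynomial.X i : MvPolynomial (Fin 2) K) ^ 1, 1, rfl⟩ :
      Submonoid.powers (MvPolynomial.X i : MvPolynomial (Fin 2) K))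
  rw [awayCoord, Away.val_mk, Localization.mk_eq_mk']
  simpa only [pow_one] using h

/-- The value of a homogeneous form of degree `n` in two variables at `(a, a b)`. -/
theorem eval₂_homogeneous_line {L : Type*} [CommRing L] (φ : K →+* L) {n : ℕ}
    {p : MvPolynomial (Fin 2) K} (hp : p ∈ lineGrading K n) (v w : Fin 2 → L) (a : L)
    (h : ∀ i, v i = a * w i) : p.eval₂ φ v = a ^ n * p.eval₂ φ w := by
  rw [MvPolynomial.eval₂_eq, MvPolynomial.eval₂_eq, Finset.mul_sum]
  refine Finset.sum_congr rfl fun d hd => ?_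
  have hdeg : ∑ i ∈ d.support, d i = n := by
    have := hp (MvPolynomial.mem_support_iff.mp hd)
    rwa [Finsupp.weight_apply, Finsupp.sum, Finset.sum_congr rfl] at this
    simp
  simp only [h, mul_pow, Finset.prod_mul_distrib, Finset.prod_pow_eq_pow_sum, hdeg]
  ring

/-- Dehomogenization `xᵢ ↦ 1`, `xⱼ ↦ T` extends to the localization and is a left inverse.
Surjectivity is the identity `p(x) = xᵢ ^ n p(x / xᵢ)` for a form `p` of degree `n`. -/
theorem awayCoord_bijective {i j : Fin 2} (hij : i ≠ j) : Function.Bijective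
    (Polynomial.eval₂RingHom (awayScalar K i) (awayCoord K i j)) := by
  set e := Polynomial.eval₂RingHom (awayScalar K i) (awayCoord K i j)
  let L := Localization.Away (MvPolynomial.X i : MvPolynomial (Fin 2) K)
  -- the map `xᵢ ↦ 1`, `xⱼ ↦ T`
  let w : Fin 2 → Polynomial K := fun l => if l = i then 1 else Polynomial.X
  let δ : MvPolynomial (Fin 2) K →+* Polynomial K := MvPolynomial.eval₂Hom Polynomial.C w
  have hδi : δ (MvPolynomial.X i) = 1 := by simp [δ, w]
  have hδj : δ (MvPolynomial.X j) = Polynomial.X := by simp [δ, w, hij.symm]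
  let δ' : L →+* Polynomial K :=
    IsLocalization.Away.lift (g := δ) (MvPolynomial.X i) (by rw [hδi]; exact isUnit_one)
  have hδ' (p) : δ' (algebraMap _ _ p) = δ p := IsLocalization.Away.lift_eq _ _ p
  let val' : Away (lineGrading K) (MvPolynomial.X i : MvPolynomial (Fin 2) K) →+* L :=
    algebraMap _ _
  have hψ : (δ'.comp val').comp e = RingHom.id _ := by
    apply Polynomial.ringHom_ext
    · intro c
      simp only [e, RingHom.comp_apply, Polynomial.coe_eval₂RingHom, Polynomial.eval₂_C,
        RingHom.id_apply]
      change δ' (awayScalar K i c).val = _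
      rw [val_awayScalar, hδ']
      simp [δ]
    · simp only [e, RingHom.comp_apply, Polynomial.coe_eval₂RingHom, Polynomial.eval₂_X,
        RingHom.id_apply]
      change δ' (awayCoord K i j).val = _
      have h2 := congrArg δ' (val_awayCoord_mul K i j)
      rwa [map_mul, hδ', hδ', hδj, hδi, mul_one] at h2
  refine ⟨Function.HasLeftInverse.injective ⟨δ'.comp val', fun p => congrArg (· p) hψ⟩,
    fun z => ?_⟩
  obtain ⟨n, p, hp, rfl⟩ := Away.mk_surjective (lineGrading K) (X_mem_lineGrading K i) z
  have hp' : p ∈ lineGrading K n := by simpa using hp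
  refine ⟨δ p, ?_⟩
  apply val_injective
  rw [Away.val_mk, Localization.mk_eq_mk', IsLocalization.eq_mk'_iff_mul_eq]
  let γ : K →+* L := val'.comp (awayScalar K i)
  have hγ : γ = (algebraMap (MvPolynomial (Fin 2) K) L).comp MvPolynomial.C := by
    ext c; exact val_awayScalar K i c
  have h1 : val' (e (δ p)) = p.eval₂ γ (fun l => val' (e (w l))) := by
    change val' (e (p.eval₂ Polynomial.C w)) = _
    rw [MvPolynomial.hom_eval₂, MvPolynomial.hom_eval₂]
    congr 1
    ext c
    simp [e, γ]
  have h2 : algebraMap _ L p =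
      p.eval₂ γ (fun l => algebraMap (MvPolynomial (Fin 2) K) L (MvPolynomial.X l)) := by
    rw [hγ]
    conv_lhs => rw [← MvPolynomial.eval₂_eta p]
    rw [MvPolynomial.hom_eval₂]
  change val' (e (δ p)) * algebraMap _ L (MvPolynomial.X i ^ n) = algebraMap _ L p
  rw [h1, h2, mul_comm, map_pow]
  refine (eval₂_homogeneous_line K γ hp' _ (fun l => val' (e (w l)))
    (algebraMap (MvPolynomial (Fin 2) K) L (MvPolynomial.X i)) ?_).symm
  intro l
  by_cases hl : l = i
  · simp [w, hl]
  · obtain rfl : l = j := by omega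
    simp only [w, hl, if_false, e, Polynomial.coe_eval₂RingHom, Polynomial.eval₂_X]
    rw [mul_comm]
    exact (val_awayCoord_mul K i l).symm

end ProjRing

/-! ### Schemes covered by two affine lines glued like the projective line -/

section LineCharts

variable {K : Type u} [Field K] {F : Scheme.{u}}

/-- The scalars `K → Γ(F, U)` of a scheme `s : F ⟶ Spec K`. -/
def sectionScalarHom (s : F ⟶ Spec (.of K)) (U : F.Opens) : K →+* Γ(F, U) :=
  ((Scheme.ΓSpecIso (.of K)).inv ≫ s.appTop ≫ F.presheaf.map (homOfLE le_top).op).hom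

theorem germ_sectionScalarHom (s : F ⟶ Spec (.of K)) (U : F.Opens) (x : F) (hx : x ∈ U) (c : K) :
    F.presheaf.germ U x hx (sectionScalarHom s U c) = scalarHom s x c := by
  simp only [sectionScalarHom, scalarHom, CommRingCat.hom_comp, RingHom.comp_apply]
  exact F.presheaf.germ_res_apply _ x hx _

/-- An affine open subscheme with a coordinate that identifies it with the affine line. -/
structure LineChart (s : F ⟶ Spec (.of K)) where
  U : F.Opens
  isAffineOpen : IsAffineOpen U
  t : Γ(F, U)
  bijective : Function.Bijective (Polynomial.eval₂RingHom (sectionScalarHom s U) t)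

/-- Two affine lines with coordinates `t₀`, `t₁` that cover `F` and are glued along
`t₀ t₁ = 1`. -/
structure ProjLineCharts (s : F ⟶ Spec (.of K)) where
  c₀ : LineChart s
  c₁ : LineChart s
  cover : ∀ x : F, x ∈ c₀.U ∨ x ∈ c₁.U
  mul_germ : ∀ (x : F) (h₀ : x ∈ c₀.U) (h₁ : x ∈ c₁.U),
    F.presheaf.germ c₀.U x h₀ c₀.t * F.presheaf.germ c₁.U x h₁ c₁.t = 1
  mem₁ : ∀ (x : F) (h₀ : x ∈ c₀.U), IsUnit (F.presheaf.germ c₀.U x h₀ c₀.t) → x ∈ c₁.U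
  mem₀ : ∀ (x : F) (h₁ : x ∈ c₁.U), IsUnit (F.presheaf.germ c₁.U x h₁ c₁.t) → x ∈ c₀.U

/-- Interchange of the two charts. -/
def ProjLineCharts.swap {s : F ⟶ Spec (.of K)} (D : ProjLineCharts s) : ProjLineCharts s where
  c₀ := D.c₁
  c₁ := D.c₀
  cover x := (D.cover x).symm
  mul_germ x h₀ h₁ := by rw [mul_comm]; exact D.mul_germ x h₁ h₀
  mem₁ := D.mem₀
  mem₀ := D.mem₁

end LineCharts

/-! ### The two standard charts of `Proj K[x₀, x₁]`. -/

section ProjCharts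

open HomogeneousLocalization

variable (K : Type u) [Field K]

theorem opensι_toSpecZero (i : Fin 2) :
    (Proj.basicOpen (lineGrading K) (MvPolynomial.X i)).ι ≫ Proj.toSpecZero (lineGrading K) =
      Proj.basicOpenToSpec (lineGrading K) (MvPolynomial.X i) ≫
        Spec.map (CommRingCat.ofHom (fromZeroRingHom (lineGrading K) _)) := by
  rw [← Proj.awayι_toSpecZero _ _ (X_mem_lineGrading K i) one_pos, Proj.awayι,
    ← Proj.basicOpenIsoSpec_hom _ _ (X_mem_lineGrading K i) one_pos]
  simp

/-- The structure morphism of the projective line. -/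
def lineStr : Proj (lineGrading K) ⟶ Spec (.of K) :=
  Proj.toSpecZero (lineGrading K) ≫ Spec.map (CommRingCat.ofHom (algebraMap K (lineGrading K 0)))

/-- Scalars defined through the structure morphism agree with those of the graded ring. This lets
the algebraic description of the chart as `K[T]` serve as a `LineChart`. -/
theorem sectionScalarHom_lineStr (i : Fin 2) (c : K) :
    sectionScalarHom (lineStr K) (Proj.basicOpen (lineGrading K) (MvPolynomial.X i)) c =
      Proj.awayToSection (lineGrading K) (MvPolynomial.X i) (awayScalar K i c) := by
  set U := Proj.basicOpen (lineGrading K) (MvPolynomial.X i)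
  have h : (Scheme.ΓSpecIso (.of K)).inv ≫ (lineStr K).appTop ≫
      (Proj (lineGrading K)).presheaf.map (homOfLE (le_top : U ≤ ⊤)).op =
      CommRingCat.ofHom (awayScalar K i) ≫
        Proj.awayToSection (lineGrading K) (MvPolynomial.X i) := by
    have h1 : U.ι ≫ lineStr K = Proj.basicOpenToSpec (lineGrading K) (MvPolynomial.X i) ≫
        Spec.map (CommRingCat.ofHom (awayScalar K i)) := by
      rw [lineStr, ← Category.assoc, opensι_toSpecZero, Category.assoc, ← Spec.map_comp]
      rfl
    have h2 := congrArg Scheme.Hom.appTop h1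
    rw [Scheme.Hom.comp_appTop, Scheme.Hom.comp_appTop] at h2
    have h3 : (Proj.basicOpenToSpec (lineGrading K) (MvPolynomial.X i)).appTop = _ :=
      Proj.basicOpenToSpec_app_top (lineGrading K) (MvPolynomial.X i)
    rw [h3, Scheme.ΓSpecIso_naturality_assoc, ← Iso.inv_comp_eq] at h2
    rw [← cancel_mono U.topIso.inv]
    simp only [Category.assoc]
    rw [← h2]
    congr 2
  exact congrArg (fun φ => φ.hom c) h

theorem bijective_awayToSection (i : Fin 2) : Function.Bijective
    (Proj.awayToSection (lineGrading K) (MvPolynomial.X i)) := by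
  have : IsIso (Proj.awayToSection (lineGrading K) (MvPolynomial.X i)) :=
    (Proj.basicOpenIsoAway _ _ (X_mem_lineGrading K i) one_pos).isIso_hom
  exact ConcreteCategory.bijective_of_isIso _

/-- The chart `xᵢ ≠ 0` of the projective line. -/
def projLineChart {i j : Fin 2} (hij : i ≠ j) : LineChart (lineStr K) where
  U := Proj.basicOpen (lineGrading K) (MvPolynomial.X i)
  isAffineOpen := Proj.isAffineOpen_basicOpen _ _ (X_mem_lineGrading K i) one_pos
  t := Proj.awayToSection (lineGrading K) (MvPolynomial.X i) (awayCoord K i j)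
  bijective := by
    have h : Polynomial.eval₂RingHom (sectionScalarHom (lineStr K)
        (Proj.basicOpen (lineGrading K) (MvPolynomial.X i)))
        (Proj.awayToSection (lineGrading K) (MvPolynomial.X i) (awayCoord K i j)) =
        (Proj.awayToSection (lineGrading K) (MvPolynomial.X i)).hom.comp
          (Polynomial.eval₂RingHom (awayScalar K i) (awayCoord K i j)) := by
      apply Polynomial.ringHom_ext
      · intro c
        simp [sectionScalarHom_lineStr]
      · simp
    rw [h, RingHom.coe_comp]
    exact (bijective_awayToSection K i).comp (awayCoord_bijective K hij)

instance (x : Proj (lineGrading K)) : x.asHomogeneousIdeal.toIdeal.IsPrime := x.isPrime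

/-- The local rings of the projective line. -/
def lineStalkEquiv (x : Proj (lineGrading K)) : (Proj (lineGrading K)).presheaf.stalk x ≃+*
    HomogeneousLocalization (lineGrading K) x.asHomogeneousIdeal.toIdeal.primeCompl :=
  Proj.stalkIso' (lineGrading K) x

theorem val_germ_awayCoord_mul {i j : Fin 2} (x : Proj (lineGrading K))
    (hi : x ∈ Proj.basicOpen (lineGrading K) (MvPolynomial.X i)) :
    (lineStalkEquiv K x ((Proj (lineGrading K)).presheaf.germ _ x hi
      (Proj.awayToSection (lineGrading K) (MvPolynomial.X i) (awayCoord K i j)))).val *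
        algebraMap (MvPolynomial (Fin 2) K) _ (MvPolynomial.X i) =
      algebraMap (MvPolynomial (Fin 2) K) _ (MvPolynomial.X j) := by
  have h := congrArg (fun φ => φ.hom (awayCoord K i j))
    (ProjectiveSpectrum.Proj.awayToSection_germ (lineGrading K) (MvPolynomial.X i) x hi)
  have h' : (Proj (lineGrading K)).presheaf.germ _ x hi
      (Proj.awayToSection (lineGrading K) (MvPolynomial.X i) (awayCoord K i j)) =
      (lineStalkEquiv K x).symm (HomogeneousLocalization.mapId (lineGrading K)
        (Submonoid.powers_le.mpr hi) (awayCoord K i j)) := h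
  rw [h', RingEquiv.apply_symm_apply]
  have h2 := IsLocalization.mk'_spec
    (Localization x.asHomogeneousIdeal.toIdeal.primeCompl)
    (MvPolynomial.X j : MvPolynomial (Fin 2) K)
    (⟨(MvPolynomial.X i : MvPolynomial (Fin 2) K) ^ 1, by rw [pow_one]; exact hi⟩ :
      x.asHomogeneousIdeal.toIdeal.primeCompl)
  rw [← Localization.mk_eq_mk'] at h2
  simp only [pow_one] at h2
  refine Eq.trans ?_ h2
  congr 1
  change Localization.mk _ _ = _
  congr 1
  ext
  simp

theorem awayCoord_germ_mul {i j : Fin 2} (x : Proj (lineGrading K))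
    (hi : x ∈ Proj.basicOpen (lineGrading K) (MvPolynomial.X i))
    (hj : x ∈ Proj.basicOpen (lineGrading K) (MvPolynomial.X j)) :
    (Proj (lineGrading K)).presheaf.germ _ x hi
      (Proj.awayToSection (lineGrading K) (MvPolynomial.X i) (awayCoord K i j)) *
    (Proj (lineGrading K)).presheaf.germ _ x hj
      (Proj.awayToSection (lineGrading K) (MvPolynomial.X j) (awayCoord K j i)) = 1 := by
  apply (lineStalkEquiv K x).injective
  rw [map_one, map_mul]
  apply val_injective
  rw [val_mul, val_one]
  have hu : IsUnit (algebraMap (MvPolynomial (Fin 2) K)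
      (Localization x.asHomogeneousIdeal.toIdeal.primeCompl) (MvPolynomial.X j)) :=
    IsLocalization.map_units _ (⟨_, hj⟩ : x.asHomogeneousIdeal.toIdeal.primeCompl)
  apply hu.mul_right_cancel
  rw [mul_assoc, val_germ_awayCoord_mul, val_germ_awayCoord_mul, one_mul]

/-- In the local ring, `xⱼ = (xⱼ / xᵢ) xᵢ` is a product of units, so `xⱼ` lies outside the prime of
`x`. -/
theorem mem_of_isUnit_awayCoord_germ {i j : Fin 2} (x : Proj (lineGrading K))
    (hi : x ∈ Proj.basicOpen (lineGrading K) (MvPolynomial.X i))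
    (h : IsUnit ((Proj (lineGrading K)).presheaf.germ _ x hi
      (Proj.awayToSection (lineGrading K) (MvPolynomial.X i) (awayCoord K i j)))) :
    x ∈ Proj.basicOpen (lineGrading K) (MvPolynomial.X j) := by
  have hu : IsUnit (algebraMap (MvPolynomial (Fin 2) K)
      (Localization x.asHomogeneousIdeal.toIdeal.primeCompl) (MvPolynomial.X i)) :=
    IsLocalization.map_units _ (⟨_, hi⟩ : x.asHomogeneousIdeal.toIdeal.primeCompl)
  have h1 := (h.map (lineStalkEquiv K x)).map
    (algebraMap _ (Localization x.asHomogeneousIdeal.toIdeal.primeCompl))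
  have h2 := h1.mul hu
  have h3 := (congrArg IsUnit (val_germ_awayCoord_mul K (j := j) x hi)).mp h2
  exact (IsLocalization.AtPrime.isUnit_to_map_iff _ x.asHomogeneousIdeal.toIdeal _).mp h3

/-- The standard charts of the projective line. -/
def projLineCharts : ProjLineCharts (lineStr K) where
  c₀ := projLineChart K zero_ne_one
  c₁ := projLineChart K one_ne_zero
  cover x := by
    -- A prime containing both variables contains every polynomial without constant term, hence the
    -- irrelevant ideal, which a point of `Proj` does not.
    by_contra hx
    have hx' : ∀ i : Fin 2, MvPolynomial.X i ∈ x.asHomogeneousIdeal := by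
      intro i
      by_contra hi
      fin_cases i
      · exact hx (.inl hi)
      · exact hx (.inr hi)
    refine x.not_irrelevant_le fun p hp => ?_
    have hp0 : MvPolynomial.coeff 0 p = 0 := by
      have h0 := (HomogeneousIdeal.mem_irrelevant_iff (lineGrading K) p).mp hp
      have h1 : MvPolynomial.homogeneousComponent 0 p = 0 :=
        (MvPolynomial.decomposition.decompose'_apply p 0).symm.trans h0
      rwa [MvPolynomial.homogeneousComponent_zero, map_eq_zero] at h1
    rw [MvPolynomial.as_sum p]
    refine Ideal.sum_mem _ fun d hd => ?_
    have hd0 : d ≠ 0 := by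
      rintro rfl
      exact MvPolynomial.mem_support_iff.mp hd hp0
    obtain ⟨i, hi⟩ := Finsupp.ne_iff.mp hd0
    rw [MvPolynomial.monomial_eq]
    refine Ideal.mul_mem_left _ _ (Ideal.mem_of_dvd _ (Finset.dvd_prod_of_mem _
      (Finsupp.mem_support_iff.mpr hi)) ?_)
    exact Ideal.pow_mem_of_mem _ (hx' i) _ (Nat.pos_of_ne_zero hi)
  mul_germ x h₀ h₁ := awayCoord_germ_mul K x h₀ h₁
  mem₁ x h₀ h := mem_of_isUnit_awayCoord_germ K x h₀ h
  mem₀ x h₁ h := mem_of_isUnit_awayCoord_germ K x h₁ h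

end ProjCharts

/-! ### Points and local rings of an affine open subscheme -/

section Affine

variable {F : Scheme.{u}} {U : F.Opens}

theorem isUnit_germ_iff (hU : IsAffineOpen U) {x : F} (hx : x ∈ U) (a : Γ(F, U)) :
    IsUnit (F.presheaf.germ U x hx a) ↔ a ∉ (hU.primeIdealOf ⟨x, hx⟩).asIdeal := by
  let := F.presheaf.algebra_section_stalk (⟨x, hx⟩ : U)
  have := hU.isLocalization_stalk ⟨x, hx⟩
  exact IsLocalization.AtPrime.isUnit_to_map_iff (F.presheaf.stalk x)
    (hU.primeIdealOf ⟨x, hx⟩).asIdeal a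

theorem exists_germ_mul_eq (hU : IsAffineOpen U) {x : F} (hx : x ∈ U) (u : F.presheaf.stalk x) :
    ∃ a b : Γ(F, U), IsUnit (F.presheaf.germ U x hx b) ∧
      u * F.presheaf.germ U x hx b = F.presheaf.germ U x hx a := by
  let := F.presheaf.algebra_section_stalk (⟨x, hx⟩ : U)
  have := hU.isLocalization_stalk ⟨x, hx⟩
  obtain ⟨⟨a, b⟩, h⟩ := IsLocalization.surj (hU.primeIdealOf ⟨x, hx⟩).asIdeal.primeCompl u
  exact ⟨a, b, (isUnit_germ_iff hU hx _).mpr b.2, h⟩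

theorem exists_mem_primeIdealOf_eq (hU : IsAffineOpen U) (q : PrimeSpectrum Γ(F, U)) :
    ∃ (x : F) (hx : x ∈ U), hU.primeIdealOf ⟨x, hx⟩ = q := by
  have hx : hU.fromSpec q ∈ U := by
    have : hU.fromSpec q ∈ Set.range hU.fromSpec := ⟨q, rfl⟩
    rwa [hU.range_fromSpec] at this
  refine ⟨hU.fromSpec q, hx, ?_⟩
  apply hU.fromSpec.isOpenEmbedding.injective
  exact hU.fromSpec_primeIdealOf ⟨_, hx⟩

theorem specializes_of_primeIdealOf_le (hU : IsAffineOpen U) {x y : F} (hx : x ∈ U) (hy : y ∈ U)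
    (h : (hU.primeIdealOf ⟨x, hx⟩).asIdeal ≤ (hU.primeIdealOf ⟨y, hy⟩).asIdeal) : x ⤳ y := by
  have h1 : hU.primeIdealOf ⟨x, hx⟩ ⤳ hU.primeIdealOf ⟨y, hy⟩ :=
    (PrimeSpectrum.le_iff_specializes _ _).mp h
  have h2 := h1.map hU.fromSpec.continuous
  rwa [hU.fromSpec_primeIdealOf, hU.fromSpec_primeIdealOf] at h2

theorem specializes_of_isUnit_germ (hU : IsAffineOpen U) {x y : F} (hx : x ∈ U) (hy : y ∈ U)
    (h : ∀ a, IsUnit (F.presheaf.germ U y hy a) → IsUnit (F.presheaf.germ U x hx a)) : x ⤳ y := by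
  refine specializes_of_primeIdealOf_le hU hx hy fun a ha => ?_
  by_contra hb
  exact (isUnit_germ_iff hU hx a).mp (h a ((isUnit_germ_iff hU hy a).mpr hb)) ha

end Affine


/-! ### Points and germs of a chart in terms of `K[T]`; integrality of the glued scheme. -/

section LineChartPoints

open Polynomial

variable {K : Type u} [Field K] {F : Scheme.{u}} {s : F ⟶ Spec (.of K)}

namespace LineChart

variable (c : LineChart s)

/-- The isomorphism of `K[T]` with the coordinate ring of a chart. -/
def equiv : K[X] ≃+* Γ(F, c.U) := RingEquiv.ofBijective _ c.bijective

/-- The germ at a point of the chart of a polynomial in the coordinate. -/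
def germ (x : F) (hx : x ∈ c.U) : K[X] →+* F.presheaf.stalk x :=
  (F.presheaf.germ c.U x hx).hom.comp c.equiv.toRingHom

@[simp]
theorem germ_C (x : F) (hx : x ∈ c.U) (a : K) : c.germ x hx (C a) = scalarHom s x a := by
  change F.presheaf.germ c.U x hx (eval₂ (sectionScalarHom s c.U) c.t (C a)) = _
  rw [eval₂_C, germ_sectionScalarHom]

@[simp]
theorem germ_X (x : F) (hx : x ∈ c.U) : c.germ x hx X = F.presheaf.germ c.U x hx c.t := by
  change F.presheaf.germ c.U x hx (eval₂ (sectionScalarHom s c.U) c.t X) = _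
  rw [eval₂_X]

theorem exists_germ_mul_eq {x : F} (hx : x ∈ c.U) (u : F.presheaf.stalk x) :
    ∃ a b : K[X], IsUnit (c.germ x hx b) ∧ u * c.germ x hx b = c.germ x hx a := by
  obtain ⟨a, b, hb, h⟩ := RuledCode.exists_germ_mul_eq c.isAffineOpen hx u
  refine ⟨c.equiv.symm a, c.equiv.symm b, ?_, ?_⟩ <;> simpa [germ]

theorem exists_point (𝔭 : Ideal K[X]) [𝔭.IsPrime] :
    ∃ (x : F) (hx : x ∈ c.U), ∀ p, IsUnit (c.germ x hx p) ↔ p ∉ 𝔭 := by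
  obtain ⟨x, hx, h⟩ := exists_mem_primeIdealOf_eq c.isAffineOpen
    ⟨𝔭.comap c.equiv.symm.toRingHom, inferInstance⟩
  refine ⟨x, hx, fun p => (isUnit_germ_iff c.isAffineOpen hx (c.equiv p)).trans ?_⟩
  rw [h]
  simp

theorem specializes {x y : F} (hx : x ∈ c.U) (hy : y ∈ c.U)
    (h : ∀ p, IsUnit (c.germ y hy p) → IsUnit (c.germ x hx p)) : x ⤳ y := by
  refine specializes_of_isUnit_germ c.isAffineOpen hx hy fun a => ?_
  simpa [germ] using h (c.equiv.symm a)

theorem isDomain_stalk {x : F} (hx : x ∈ c.U) : IsDomain (F.presheaf.stalk x) := by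
  let := F.presheaf.algebra_section_stalk (⟨x, hx⟩ : c.U)
  have := c.isAffineOpen.isLocalization_stalk ⟨x, hx⟩
  have : IsDomain Γ(F, c.U) := c.equiv.symm.toMulEquiv.isDomain _
  exact IsLocalization.isDomain_of_atPrime (F.presheaf.stalk x)
    (c.isAffineOpen.primeIdealOf ⟨x, hx⟩).asIdeal

theorem germ_injective [IsIntegral F] {x : F} (hx : x ∈ c.U) : Function.Injective (c.germ x hx) :=
  (germ_injective_of_isIntegral F x hx).comp c.equiv.injective

end LineChart

/-- The zero ideals of the two charts give points at which both coordinates are units. Each lies in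
the other chart, so they coincide, and this one point specializes to all of `F`. Reducedness holds
because the stalks are domains. -/
theorem ProjLineCharts.isIntegral (D : ProjLineCharts s) : IsIntegral F := by
  obtain ⟨x, hx, h⟩ := D.c₀.exists_point ⊥
  obtain ⟨y, hy, h'⟩ := D.c₁.exists_point ⊥
  have hx' : x ∈ D.c₁.U := D.mem₁ x hx (by
    rw [← LineChart.germ_X, h]; exact X_ne_zero)
  have hy' : y ∈ D.c₀.U := D.mem₀ y hy (by
    rw [← LineChart.germ_X, h']; exact X_ne_zero)
  have hsp (z) (hz : z ∈ D.c₀.U) : x ⤳ z := by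
    have := D.c₀.isDomain_stalk hz
    refine D.c₀.specializes hx hz fun p hp => (h p).mpr ?_
    rintro rfl
    simp at hp
  have hsp' (z) (hz : z ∈ D.c₁.U) : y ⤳ z := by
    have := D.c₁.isDomain_stalk hz
    refine D.c₁.specializes hy hz fun p hp => (h' p).mpr ?_
    rintro rfl
    simp at hp
  have hxy : x = y := ((hsp y hy').antisymm (hsp' x hx')).eq
  have hall (z : F) : x ⤳ z := (D.cover z).elim (hsp z) (fun hz => hxy ▸ hsp' z hz)
  have : IsReduced F := by
    have (z : F) : _root_.IsReduced (F.presheaf.stalk z) := by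
      rcases D.cover z with hz | hz
      · have := D.c₀.isDomain_stalk hz
        infer_instance
      · have := D.c₁.isDomain_stalk hz
        infer_instance
    exact isReduced_of_isReduced_stalk F
  have : IrreducibleSpace F := by
    have : closure {x} = (Set.univ : Set F) :=
      Set.eq_univ_of_forall fun z => specializes_iff_mem_closure.mp (hall z)
    have h2 := (isIrreducible_singleton (x := x)).closure
    rw [this] at h2
    exact (irreducibleSpace_def F).mpr h2
  exact isIntegral_of_irreducibleSpace_of_isReduced F

/-! Transport along isomorphisms. -/

variable {F' : Scheme.{u}} {s' : F' ⟶ Spec (.of K)}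

theorem sectionScalarHom_preimage (φ : F' ⟶ F) (h : φ ≫ s = s') (U : F.Opens) (a : K) :
    sectionScalarHom s' (φ ⁻¹ᵁ U) a = φ.app U (sectionScalarHom s U a) := by
  subst h
  simp only [sectionScalarHom, CommRingCat.hom_comp, RingHom.comp_apply, Scheme.Hom.comp_appTop]
  exact (congrArg (fun ψ => ψ.hom (s.appTop.hom ((Scheme.ΓSpecIso (.of K)).inv.hom a)))
    (φ.naturality (homOfLE (le_top : U ≤ ⊤)).op)).symm

/-- The inverse image of a chart under an isomorphism. -/
def LineChart.preimage (c : LineChart s) (φ : F' ⟶ F) [IsIso φ] (h : φ ≫ s = s') :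
    LineChart s' where
  U := φ ⁻¹ᵁ c.U
  isAffineOpen := c.isAffineOpen.preimage_of_isIso φ
  t := φ.app c.U c.t
  bijective := by
    have h1 : eval₂RingHom (sectionScalarHom s' (φ ⁻¹ᵁ c.U)) (φ.app c.U c.t) =
        (φ.app c.U).hom.comp (eval₂RingHom (sectionScalarHom s c.U) c.t) := by
      apply Polynomial.ringHom_ext
      · intro a
        simp [sectionScalarHom_preimage φ h]
      · simp
    rw [h1, RingHom.coe_comp]
    exact (ConcreteCategory.bijective_of_isIso (φ.app c.U)).comp c.bijective

theorem LineChart.germ_preimage_t (c : LineChart s) (φ : F' ⟶ F) [IsIso φ] (h : φ ≫ s = s')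
    (x : F') (hx : x ∈ (c.preimage φ h).U) :
    F'.presheaf.germ (c.preimage φ h).U x hx (c.preimage φ h).t =
      φ.stalkMap x (F.presheaf.germ c.U (φ x) hx c.t) :=
  (φ.germ_stalkMap_apply c.U x hx c.t).symm

/-- The inverse images of the two charts under an isomorphism. -/
def ProjLineCharts.preimage (D : ProjLineCharts s) (φ : F' ⟶ F) [IsIso φ] (h : φ ≫ s = s') :
    ProjLineCharts s' where
  c₀ := D.c₀.preimage φ h
  c₁ := D.c₁.preimage φ h
  cover x := D.cover (φ x)
  mul_germ x h₀ h₁ := by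
    rw [LineChart.germ_preimage_t, LineChart.germ_preimage_t, ← map_mul]
    exact (congrArg (φ.stalkMap x) (D.mul_germ (φ x) h₀ h₁)).trans (map_one _)
  mem₁ x h₀ hu := D.mem₁ (φ x) h₀ (by
    rw [LineChart.germ_preimage_t] at hu
    exact (isUnit_map_iff (φ.stalkMap x).hom _).mp hu)
  mem₀ x h₁ hu := D.mem₀ (φ x) h₁ (by
    rw [LineChart.germ_preimage_t] at hu
    exact (isUnit_map_iff (φ.stalkMap x).hom _).mp hu)

end LineChartPoints

/-- A scheme over `K` isomorphic to the projective line has the two standard charts. -/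
theorem nonempty_projLineCharts {K : Type u} [Field K] {F : Scheme.{u}} {s : F ⟶ Spec (.of K)}
    (h : Nonempty (Over.mk s ≅ projLine K)) : Nonempty (ProjLineCharts s) := by
  obtain ⟨e⟩ := h
  let φ : F ⟶ Proj (lineGrading K) := e.hom.left
  have hφ : φ ≫ lineStr K = s := Over.w e.hom
  have : IsIso φ := ⟨e.inv.left, by
    exact congrArg CommaMorphism.left e.hom_inv_id, by
    exact congrArg CommaMorphism.left e.inv_hom_id⟩
  exact ⟨(projLineCharts K).preimage φ hφ⟩

/-! ### Rational points of the projective line -/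

section LineRationalPoints

open Polynomial

variable {K : Type u} [Field K] {F : Scheme.{u}} {s : F ⟶ Spec (.of K)}

theorem value_eq_zero_iff (P : RationalPoint s) (u : F.presheaf.stalk P.1) :
    value s P u = 0 ↔ ¬ IsUnit u := by
  rw [← mem_nonunits_iff, ← IsLocalRing.mem_maximalIdeal]
  change (RingEquiv.ofBijective _ P.2).symm ((F.residue P.1).hom u) = 0 ↔ _
  rw [map_eq_zero_iff _ (RingEquiv.injective _)]
  exact IsLocalRing.residue_eq_zero_iff u

namespace LineChart

variable (c : LineChart s)

/-- The coordinate of a rational point. -/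
def coord (P : RationalPoint s) (hP : P.1 ∈ c.U) : K :=
  value s P (F.presheaf.germ c.U P.1 hP c.t)

theorem value_germ (P : RationalPoint s) (hP : P.1 ∈ c.U) (p : K[X]) :
    value s P (c.germ P.1 hP p) = p.eval (c.coord P hP) := by
  have : (value s P).comp (c.germ P.1 hP) = evalRingHom (c.coord P hP) := by
    apply Polynomial.ringHom_ext
    · intro a
      simp [value_scalarHom]
    · simp [coord]
  exact congrArg (fun φ => φ p) this

theorem isUnit_germ_iff_eval_ne_zero (P : RationalPoint s) (hP : P.1 ∈ c.U) (p : K[X]) :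
    IsUnit (c.germ P.1 hP p) ↔ p.eval (c.coord P hP) ≠ 0 := by
  rw [← c.value_germ P hP, Ne, value_eq_zero_iff, not_not]

theorem coord_injective {P Q : RationalPoint s} (hP : P.1 ∈ c.U) (hQ : Q.1 ∈ c.U)
    (h : c.coord P hP = c.coord Q hQ) : P = Q := by
  apply Subtype.ext
  refine ((c.specializes hP hQ fun p => ?_).antisymm (c.specializes hQ hP fun p => ?_)).eq <;>
  simp [isUnit_germ_iff_eval_ne_zero, h]

theorem residue_germ {x : F} (hx : x ∈ c.U) {a : K} (ha : ¬ IsUnit (c.germ x hx (X - C a)))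
    (p : K[X]) : (F.residue x).hom (c.germ x hx p) = residueScalarHom s x (p.eval a) := by
  obtain ⟨r, hr⟩ := X_sub_C_dvd_sub_C_eval (a := a) (p := p)
  have h0 : (F.residue x).hom (c.germ x hx (X - C a)) = 0 := by
    exact (IsLocalRing.residue_eq_zero_iff _).mpr ha
  have h1 := congrArg (fun p => (F.residue x).hom (c.germ x hx p)) hr
  simp only [map_mul, h0, zero_mul] at h1
  rw [map_sub, map_sub, sub_eq_zero, germ_C] at h1
  exact h1

/-- Modulo `T - a` every polynomial is its value at `a`, so every residue class is a quotient of two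
scalars. -/
theorem isRational {x : F} (hx : x ∈ c.U) {a : K} (ha : ¬ IsUnit (c.germ x hx (X - C a))) :
    Function.Bijective (residueScalarHom s x) := by
  refine ⟨(residueScalarHom s x).injective, fun z => ?_⟩
  obtain ⟨u, rfl⟩ := F.residue_surjective x z
  obtain ⟨p, r, hr, h⟩ := c.exists_germ_mul_eq hx u
  have h1 := congrArg (F.residue x).hom h
  rw [map_mul, c.residue_germ hx ha, c.residue_germ hx ha] at h1
  have h2 : residueScalarHom s x (r.eval a) ≠ 0 := by
    rw [← c.residue_germ hx ha]
    exact (hr.map (F.residue x).hom).ne_zero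
  refine ⟨p.eval a / r.eval a, ?_⟩
  rw [map_div₀, div_eq_iff h2]
  exact h1.symm

theorem coord_eq {P : RationalPoint s} (hP : P.1 ∈ c.U) {a : K}
    (ha : ¬ IsUnit (c.germ P.1 hP (X - C a))) : c.coord P hP = a := by
  rw [isUnit_germ_iff_eval_ne_zero, not_not] at ha
  simpa [sub_eq_zero] using ha

theorem exists_coord_eq (a : K) : ∃ (P : RationalPoint s) (hP : P.1 ∈ c.U), c.coord P hP = a := by
  have : (Ideal.span {X - C a} : Ideal K[X]).IsPrime :=
    (Ideal.span_singleton_prime (X_sub_C_ne_zero a)).mpr (prime_X_sub_C a)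
  obtain ⟨x, hx, h⟩ := c.exists_point (Ideal.span {X - C a})
  have ha : ¬ IsUnit (c.germ x hx (X - C a)) := by
    rw [h, not_not]; exact Ideal.mem_span_singleton_self _
  exact ⟨⟨x, c.isRational hx ha⟩, hx, c.coord_eq (P := ⟨x, c.isRational hx ha⟩) hx ha⟩

theorem span_germ_eq (P : RationalPoint s) (hP : P.1 ∈ c.U) :
    Ideal.span {c.germ P.1 hP (X - C (c.coord P hP))} =
      IsLocalRing.maximalIdeal (F.presheaf.stalk P.1) := by
  apply le_antisymm
  · rw [Ideal.span_singleton_le_iff_mem, IsLocalRing.mem_maximalIdeal, mem_nonunits_iff,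
      isUnit_germ_iff_eval_ne_zero]
    simp
  · intro u hu
    rw [IsLocalRing.mem_maximalIdeal, mem_nonunits_iff, ← value_eq_zero_iff] at hu
    obtain ⟨p, r, hr, h⟩ := c.exists_germ_mul_eq hP u
    have h1 := congrArg (value s P) h
    rw [map_mul, hu, zero_mul, c.value_germ, eq_comm] at h1
    obtain ⟨v, hv⟩ := dvd_iff_isRoot.mpr h1
    rw [Ideal.mem_span_singleton, ← hr.dvd_mul_right, h, hv, map_mul]
    exact dvd_mul_right _ _

theorem genericPoint_mem [IsIntegral F] : genericPoint F ∈ c.U := by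
  obtain ⟨P, hP, -⟩ := c.exists_coord_eq 0
  exact ((genericPoint_spec F).mem_open_set_iff c.U.isOpen).mpr ⟨P.1, trivial, hP⟩

/-- A polynomial in the coordinate as a rational function. -/
def toFunctionField [IsIntegral F] : K[X] →+* F.functionField :=
  c.germ (genericPoint F) c.genericPoint_mem

theorem algebraMap_germ [IsIntegral F] {x : F} (hx : x ∈ c.U) (p : K[X]) :
    algebraMap (F.presheaf.stalk x) F.functionField (c.germ x hx p) = c.toFunctionField p := by
  have h := F.presheaf.germ_stalkSpecializes hx
    ((genericPoint_spec F).specializes (trivial : x ∈ (Set.univ : Set F)))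
  exact congrArg (fun φ => φ.hom (c.equiv p)) h

theorem toFunctionField_injective [IsIntegral F] : Function.Injective c.toFunctionField :=
  c.germ_injective _

/-- A rational function that is regular at all points of the chart is a polynomial. -/
theorem exists_toFunctionField_eq [IsIntegral F] {ψ : F.functionField}
    (h : ∀ x ∈ c.U, ∃ v : F.presheaf.stalk x, algebraMap _ F.functionField v = ψ) :
    ∃ p, c.toFunctionField p = ψ := by
  -- The ideal of denominators of `ψ`. Regularity at the point of each maximal ideal `𝔪` gives a
  -- denominator outside `𝔪`, so `I` is the unit ideal.
  let I : Ideal K[X] :=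
    { carrier := {r | ∃ p, c.toFunctionField p = ψ * c.toFunctionField r}
      zero_mem' := ⟨0, by simp⟩
      add_mem' := by
        rintro r r' ⟨p, hp⟩ ⟨p', hp'⟩
        exact ⟨p + p', by rw [map_add, map_add, hp, hp', mul_add]⟩
      smul_mem' := by
        rintro w r ⟨p, hp⟩
        exact ⟨w * p, by rw [smul_eq_mul, map_mul, map_mul, hp]; ring⟩ }
  have hI : I = ⊤ := by
    by_contra hI
    obtain ⟨𝔪, h𝔪, hle⟩ := Ideal.exists_le_maximal I hI
    have := h𝔪.isPrime
    obtain ⟨x, hx, hpt⟩ := c.exists_point 𝔪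
    obtain ⟨v, hv⟩ := h x hx
    obtain ⟨p, r, hr, hpr⟩ := c.exists_germ_mul_eq hx v
    refine (hpt r).mp hr (hle ⟨p, ?_⟩)
    rw [← c.algebraMap_germ hx, ← c.algebraMap_germ hx, ← hpr, map_mul, hv]
  obtain ⟨p, hp⟩ : (1 : K[X]) ∈ I := hI ▸ trivial
  exact ⟨p, by simpa using hp⟩

end LineChart

namespace ProjLineCharts

variable (D : ProjLineCharts s)

theorem coord_eq_zero_of_notMem {P : RationalPoint s} (hP : P.1 ∈ D.c₁.U) (h : P.1 ∉ D.c₀.U) :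
    D.c₁.coord P hP = 0 := by
  rw [LineChart.coord, value_eq_zero_iff]
  exact fun hu => h (D.mem₀ P.1 hP hu)

theorem exists_notMem : ∃ (P : RationalPoint s) (hP : P.1 ∈ D.c₁.U),
    D.c₁.coord P hP = 0 ∧ P.1 ∉ D.c₀.U := by
  obtain ⟨P, hP, h⟩ := D.c₁.exists_coord_eq 0
  refine ⟨P, hP, h, fun hP₀ => ?_⟩
  rw [LineChart.coord, value_eq_zero_iff] at h
  exact h (IsUnit.of_mul_eq_one_right _ (D.mul_germ P.1 hP₀ hP))

theorem eq_of_notMem {P Q : RationalPoint s} (hP : P.1 ∉ D.c₀.U) (hQ : Q.1 ∉ D.c₀.U) : P = Q := by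
  have hP' := (D.cover P.1).resolve_left hP
  have hQ' := (D.cover Q.1).resolve_left hQ
  exact D.c₁.coord_injective hP' hQ' (by
    rw [D.coord_eq_zero_of_notMem hP' hP, D.coord_eq_zero_of_notMem hQ' hQ])

open Classical in
/-- The projective line over a field with `q` elements has `q + 1` rational points. -/
theorem card_rationalPoint (D : ProjLineCharts s) [Finite K] :
    Finite (RationalPoint s) ∧ Nat.card (RationalPoint s) = Nat.card K + 1 := by
  let φ : RationalPoint s → Option K := fun P =>
    if hP : P.1 ∈ D.c₀.U then some (D.c₀.coord P hP) else none
  have hφ : Function.Bijective φ := by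
    constructor
    · intro P Q h
      by_cases hP : P.1 ∈ D.c₀.U <;> by_cases hQ : Q.1 ∈ D.c₀.U <;> simp [φ, hP, hQ] at h
      · exact D.c₀.coord_injective hP hQ h
      · exact D.eq_of_notMem hP hQ
    · rintro (_ | a)
      · obtain ⟨P, -, -, hP⟩ := D.exists_notMem
        exact ⟨P, by simp [φ, hP]⟩
      · obtain ⟨P, hP, h⟩ := D.c₀.exists_coord_eq a
        exact ⟨P, by simp [φ, hP, h]⟩
  refine ⟨Finite.of_injective φ hφ.1, ?_⟩
  rw [Nat.card_eq_of_bijective φ hφ, Finite.card_option]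

end ProjLineCharts

end LineRationalPoints

/-! ### Zeros of sections on the projective line -/

theorem map_units_zpow {R L : Type*} [CommRing R] [Field L] (φ : R →+* L) (w : Rˣ) (n : ℤ) :
    φ ((w ^ n : Rˣ) : R) = φ w ^ n := by
  have h : Units.map φ.toMonoidHom (w ^ n) = Units.map φ.toMonoidHom w ^ n := map_zpow _ _ _
  have h' := congrArg Units.val h
  rwa [Units.val_zpow_eq_zpow_val] at h'

section LineZeros

open Polynomial

variable {K : Type u} [Field K] {F : Scheme.{u}} {s : F ⟶ Spec (.of K)}

namespace ProjLineCharts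

theorem toFunctionField_mul_inv [IsIntegral F] (D : ProjLineCharts s) :
    D.c₀.toFunctionField X * D.c₁.toFunctionField X = 1 := by
  simp only [LineChart.toFunctionField, LineChart.germ_X]
  exact D.mul_germ _ _ _

theorem toFunctionField_C [IsIntegral F] (D : ProjLineCharts s) (a : K) :
    D.c₀.toFunctionField (C a) = D.c₁.toFunctionField (C a) := by
  simp only [LineChart.toFunctionField, LineChart.germ_C]

theorem toFunctionField_eq_reverse [IsIntegral F] (D : ProjLineCharts s) (p : K[X]) :
    D.c₀.toFunctionField p =
      D.c₁.toFunctionField p.reverse * D.c₀.toFunctionField X ^ p.natDegree := by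
  have hinv : Invertible (D.c₀.toFunctionField X) :=
    ⟨D.c₁.toFunctionField X, by rw [mul_comm]; exact D.toFunctionField_mul_inv,
      D.toFunctionField_mul_inv⟩
  have h := eval₂_reverse_mul_pow (D.c₀.toFunctionField.comp C) (D.c₀.toFunctionField X) p
  have h0 (q : K[X]) : eval₂ (D.c₀.toFunctionField.comp C) (D.c₀.toFunctionField X) q =
      D.c₀.toFunctionField q := by
    rw [← hom_eval₂, eval₂_C_X]
  have hi : ⅟(D.c₀.toFunctionField X) = D.c₁.toFunctionField X :=
    invOf_eq_right_inv D.toFunctionField_mul_inv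
  have h1 (q : K[X]) : eval₂ (D.c₀.toFunctionField.comp C) (D.c₁.toFunctionField X) q =
      D.c₁.toFunctionField q := by
    have : D.c₀.toFunctionField.comp C = D.c₁.toFunctionField.comp C :=
      RingHom.ext D.toFunctionField_C
    rw [this, ← hom_eval₂, eval₂_C_X]
  rw [hi, h1, h0] at h
  exact h.symm

theorem toFunctionField_X_sub_C [IsIntegral F] (D : ProjLineCharts s) (a : K) :
    D.c₀.toFunctionField (X - C a) =
      D.c₁.toFunctionField (1 - C a * X) * D.c₀.toFunctionField X := by
  have h := D.toFunctionField_mul_inv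
  rw [map_sub, map_sub, map_mul, map_one, D.toFunctionField_C]
  linear_combination (D.c₁.toFunctionField (C a)) * h

/-- The order of vanishing at infinity: a unit times `t₁ ^ m` is regular at a point with `t₁ = 0`
only if `0 ≤ m`, and vanishes there only if `0 < m`. -/
theorem zpow_regular [IsIntegral F] (c : LineChart s) {P : RationalPoint s} (hP : P.1 ∈ c.U)
    (h0 : c.coord P hP = 0) {m : ℤ} (ω u : F.presheaf.stalk P.1) (hω : IsUnit ω)
    (h : algebraMap _ F.functionField u = c.toFunctionField X ^ m * algebraMap _ _ ω) :
    0 ≤ m ∧ (¬ IsUnit u → 0 < m) := by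
  have hX : ¬ IsUnit (c.germ P.1 hP X) := by
    rw [LineChart.isUnit_germ_iff_eval_ne_zero]
    simp [h0]
  have hX0 : c.toFunctionField X ≠ 0 :=
    (map_ne_zero_iff _ c.toFunctionField_injective).mpr X_ne_zero
  have hinj := IsFractionRing.injective (F.presheaf.stalk P.1) F.functionField
  have h0m : 0 ≤ m := by
    by_contra hm
    obtain ⟨n, hn⟩ : ∃ n : ℕ, m = -((n + 1 : ℕ) : ℤ) := ⟨(-m - 1).toNat, by omega⟩
    rw [hn, zpow_neg, zpow_natCast, eq_inv_mul_iff_mul_eq₀ (pow_ne_zero _ hX0),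
      ← c.algebraMap_germ hP, ← map_pow, ← map_mul] at h
    have h2 := hinj h
    rw [← h2] at hω
    exact hX (isUnit_of_dvd_unit (dvd_mul_of_dvd_left (dvd_pow_self _ (by omega)) _) hω)
  refine ⟨h0m, fun hu => lt_of_le_of_ne h0m ?_⟩
  rintro rfl
  rw [zpow_zero, one_mul] at h
  exact hu (hinj h ▸ hω)

/-- If `x₀` has coordinate `a`, then `ψ (t₀ - a) ^ b` is regular on the first chart, hence a
polynomial `p`. The zeros in that chart are roots of `p`, and the order at the one remaining point
is `b - deg p`. -/
theorem zeros_le_of_mem [IsIntegral F] (D : ProjLineCharts s) (x₀ : RationalPoint s)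
    (hx₀ : x₀.1 ∈ D.c₀.U) (g : F.presheaf.stalk x₀.1)
    (hg : Ideal.span {g} = IsLocalRing.maximalIdeal (F.presheaf.stalk x₀.1))
    (ψ : F.functionField) (hψ : ψ ≠ 0) (b : ℤ) (u : ∀ x : F, F.presheaf.stalk x)
    (hu : ∀ x, x ≠ x₀.1 → algebraMap _ F.functionField (u x) = ψ)
    (hu₀ : algebraMap _ F.functionField (u x₀.1) = ψ * algebraMap _ F.functionField g ^ b) :
    0 ≤ b ∧ {P : RationalPoint s | ¬ IsUnit (u P.1)}.encard ≤ b.toNat := by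
  set a := D.c₀.coord x₀ hx₀ with ha
  have hℓ0 : D.c₀.toFunctionField (X - C a) ≠ 0 :=
    (map_ne_zero_iff _ D.c₀.toFunctionField_injective).mpr (X_sub_C_ne_zero a)
  have hreg (x : F) (hx : x ∈ D.c₀.U) : ∃ w : (F.presheaf.stalk x)ˣ,
      algebraMap _ F.functionField (u x * w) = ψ * D.c₀.toFunctionField (X - C a) ^ b := by
    by_cases hxx : x = x₀.1
    · subst hxx
      have hass : Associated g (D.c₀.germ x₀.1 hx₀ (X - C a)) := by
        rw [← Ideal.span_singleton_eq_span_singleton, hg, ha, LineChart.span_germ_eq]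
      obtain ⟨w, hw⟩ := hass
      refine ⟨w ^ b, ?_⟩
      rw [map_mul, hu₀, ← D.c₀.algebraMap_germ hx₀, ← hw, map_mul, mul_zpow, mul_assoc]
      congr 2
      exact map_units_zpow _ w b
    · have hunit : IsUnit (D.c₀.germ x hx (X - C a)) := by
        by_contra hn
        apply hxx
        exact congrArg Subtype.val (D.c₀.coord_injective (P := ⟨x, D.c₀.isRational hx hn⟩) hx hx₀
          (D.c₀.coord_eq (P := ⟨x, D.c₀.isRational hx hn⟩) hx hn))
      obtain ⟨w, hw⟩ := hunit
      refine ⟨w ^ b, ?_⟩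
      rw [map_mul, hu x hxx, ← D.c₀.algebraMap_germ hx, ← hw]
      congr 1
      exact map_units_zpow _ w b
  obtain ⟨p, hp⟩ := D.c₀.exists_toFunctionField_eq
    (ψ := ψ * D.c₀.toFunctionField (X - C a) ^ b) fun x hx => by
      obtain ⟨w, hw⟩ := hreg x hx
      exact ⟨_, hw⟩
  have hp0 : p ≠ 0 := by
    rintro rfl
    rw [map_zero, eq_comm, mul_eq_zero] at hp
    exact hp.elim hψ (zpow_ne_zero b hℓ0)
  have hroot (P : RationalPoint s) (hP : P.1 ∈ D.c₀.U) (hPu : ¬ IsUnit (u P.1)) :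
      p.eval (D.c₀.coord P hP) = 0 := by
    obtain ⟨w, hw⟩ := hreg P.1 hP
    rw [← hp, ← D.c₀.algebraMap_germ hP] at hw
    have := IsFractionRing.injective (F.presheaf.stalk P.1) F.functionField hw
    by_contra hne
    rw [← Ne, ← D.c₀.isUnit_germ_iff_eval_ne_zero P hP, ← this] at hne
    exact hPu (isUnit_of_mul_isUnit_left hne)
  obtain ⟨Q, hQ, hQ0, hQn⟩ := D.exists_notMem
  have hQx : Q.1 ≠ x₀.1 := fun h => hQn (h ▸ hx₀)
  have hT := D.toFunctionField_mul_inv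
  have hT0 : D.c₀.toFunctionField X ≠ 0 := left_ne_zero_of_mul_eq_one hT
  -- At `t₁ = 0` the reversed polynomial takes the leading coefficient of `p` as its value.
  have hrev : IsUnit (D.c₁.germ Q.1 hQ p.reverse) := by
    rw [LineChart.isUnit_germ_iff_eval_ne_zero, hQ0, ← coeff_zero_eq_eval_zero, coeff_zero_reverse]
    exact leadingCoeff_ne_zero.mpr hp0
  have hlin : IsUnit (D.c₁.germ Q.1 hQ (1 - C a * X)) := by
    rw [LineChart.isUnit_germ_iff_eval_ne_zero, hQ0]
    simp
  obtain ⟨w, hw⟩ := hlin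
  have hw' : algebraMap _ F.functionField ((w ^ (-b) : (F.presheaf.stalk Q.1)ˣ) : F.presheaf.stalk Q.1) =
      D.c₁.toFunctionField (1 - C a * X) ^ (-b) := by
    rw [← D.c₁.algebraMap_germ hQ, ← hw]
    exact map_units_zpow _ w (-b)
  -- Substituting `t₀ - a = (1 - a t₁) t₀` and `p(t₀) = p.reverse(t₁) t₀ ^ deg p` in `ψ = p (t₀ - a)
  -- ^ (-b)` leaves a unit at `Q` times `t₁ ^ (b - deg p)`.
  have hinf := zpow_regular D.c₁ hQ hQ0 (m := b - p.natDegree)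
    (D.c₁.germ Q.1 hQ p.reverse * (w ^ (-b) : (F.presheaf.stalk Q.1)ˣ)) (u Q.1)
    (hrev.mul (Units.isUnit _)) (by
      rw [hu Q.1 hQx, map_mul, hw', D.c₁.algebraMap_germ hQ]
      have h1 := hp
      rw [D.toFunctionField_eq_reverse, D.toFunctionField_X_sub_C, mul_zpow] at h1
      rw [eq_inv_of_mul_eq_one_right hT]
      have h2 : D.c₁.toFunctionField (1 - C a * X) ≠ 0 := by
        intro h
        rw [D.toFunctionField_X_sub_C, h, zero_mul] at hℓ0
        exact hℓ0 rfl
      rw [inv_zpow', neg_sub, zpow_sub₀ hT0, zpow_neg, zpow_natCast]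
      field_simp
      linear_combination -h1)
  refine ⟨by omega, ?_⟩
  have hZ₀ : {P : RationalPoint s | P.1 ∈ D.c₀.U ∧ ¬ IsUnit (u P.1)}.encard ≤ p.natDegree := by
    classical
    let φ : RationalPoint s → K := fun P => if hP : P.1 ∈ D.c₀.U then D.c₀.coord P hP else 0
    have hinj : Set.InjOn φ {P : RationalPoint s | P.1 ∈ D.c₀.U ∧ ¬ IsUnit (u P.1)} := by
      rintro P ⟨hP, -⟩ P' ⟨hP', -⟩ h
      simp only [φ, hP, hP', dif_pos] at h
      exact D.c₀.coord_injective hP hP' h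
    rw [← hinj.encard_image]
    refine (Set.encard_le_encard (t := (p.roots.toFinset : Set K)) ?_).trans ?_
    · rintro _ ⟨P, ⟨hP, hPu⟩, rfl⟩
      simp only [φ, hP, dif_pos, Finset.mem_coe, Multiset.mem_toFinset, mem_roots hp0, IsRoot.def]
      exact hroot P hP hPu
    · rw [Set.encard_coe_eq_coe_finsetCard]
      exact_mod_cast (Multiset.toFinset_card_le _).trans (card_roots' p)
  -- The point at infinity adds one zero to the roots of `p` only if `u` vanishes there, and then
  -- `deg p < b` makes room for it.
  by_cases hQu : IsUnit (u Q.1)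
  · have hsub : {P : RationalPoint s | ¬ IsUnit (u P.1)} ⊆
        {P : RationalPoint s | P.1 ∈ D.c₀.U ∧ ¬ IsUnit (u P.1)} := by
      intro P hP
      refine ⟨?_, hP⟩
      by_contra hn
      obtain rfl := D.eq_of_notMem hn hQn
      exact hP hQu
    refine (Set.encard_le_encard hsub).trans (hZ₀.trans ?_)
    have := hinf.1
    exact_mod_cast (by omega : p.natDegree ≤ b.toNat)
  · have hsub : {P : RationalPoint s | ¬ IsUnit (u P.1)} ⊆
        insert Q {P : RationalPoint s | P.1 ∈ D.c₀.U ∧ ¬ IsUnit (u P.1)} := by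
      intro P hP
      by_cases hn : P.1 ∈ D.c₀.U
      · exact .inr ⟨hn, hP⟩
      · exact .inl (D.eq_of_notMem hn hQn)
    refine (Set.encard_le_encard hsub).trans ((Set.encard_insert_le _ _).trans ?_)
    refine (add_le_add_left hZ₀ 1).trans ?_
    have := hinf.2 hQu
    exact_mod_cast (by omega : p.natDegree + 1 ≤ b.toNat)

/-- A nonzero section of `𝒪(b x₀)` on the projective line, given by a rational function `ψ`
with local germs `u x`, exists only for `0 ≤ b`, and has at most `b` rational zeros. -/
theorem zeros_le [IsIntegral F] (D : ProjLineCharts s) (x₀ : RationalPoint s)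
    (g : F.presheaf.stalk x₀.1)
    (hg : Ideal.span {g} = IsLocalRing.maximalIdeal (F.presheaf.stalk x₀.1))
    (ψ : F.functionField) (hψ : ψ ≠ 0) (b : ℤ) (u : ∀ x : F, F.presheaf.stalk x)
    (hu : ∀ x, x ≠ x₀.1 → algebraMap _ F.functionField (u x) = ψ)
    (hu₀ : algebraMap _ F.functionField (u x₀.1) = ψ * algebraMap _ F.functionField g ^ b) :
    0 ≤ b ∧ {P : RationalPoint s | ¬ IsUnit (u P.1)}.encard ≤ b.toNat :=
  (D.cover x₀.1).elim (fun h => D.zeros_le_of_mem x₀ h g hg ψ hψ b u hu hu₀)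
    (fun h => D.swap.zeros_le_of_mem x₀ h g hg ψ hψ b u hu hu₀)

/-- The maximal ideal at a rational point is principal and nonzero. -/
theorem exists_span_eq_maximalIdeal [IsIntegral F] (D : ProjLineCharts s) (x₀ : RationalPoint s) :
    ∃ g : F.presheaf.stalk x₀.1, g ≠ 0 ∧
      Ideal.span {g} = IsLocalRing.maximalIdeal (F.presheaf.stalk x₀.1) := by
  have key (c : LineChart s) (h : x₀.1 ∈ c.U) : ∃ g : F.presheaf.stalk x₀.1, g ≠ 0 ∧
      Ideal.span {g} = IsLocalRing.maximalIdeal (F.presheaf.stalk x₀.1) :=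
    ⟨_, (map_ne_zero_iff _ (c.germ_injective h)).mpr (X_sub_C_ne_zero _), c.span_germ_eq x₀ h⟩
  exact (D.cover x₀.1).elim (key _) (key _)

end ProjLineCharts

end LineZeros

/-! ### Scalars, rational points and fibres -/

theorem map_maximalIdeal_le {R S : Type*} [CommRing R] [CommRing S] [IsLocalRing R]
    [IsLocalRing S] (φ : R →+* S) [IsLocalHom φ] :
    (IsLocalRing.maximalIdeal R).map φ ≤ IsLocalRing.maximalIdeal S :=
  Ideal.map_le_iff_le_comap.mpr fun r hr => by
    rw [Ideal.mem_comap, IsLocalRing.mem_maximalIdeal]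
    exact map_mem_nonunits_iff φ r |>.mpr hr

section Scalars

variable {k : Type u} [Field k]

theorem stalkMap_scalarHom {X Y : Scheme.{u}} (φ : Y ⟶ X) (s : X ⟶ Spec (.of k)) (y : Y) (c : k) :
    φ.stalkMap y (scalarHom s (φ y) c) = scalarHom (φ ≫ s) y c := by
  simp only [scalarHom, CommRingCat.hom_comp, RingHom.comp_apply, Scheme.Hom.comp_appTop]
  exact φ.germ_stalkMap_apply ⊤ y trivial _

theorem residueFieldMap_residueScalarHom {X Y : Scheme.{u}} (φ : Y ⟶ X) (s : X ⟶ Spec (.of k))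
    (y : Y) (c : k) :
    φ.residueFieldMap y (residueScalarHom s (φ y) c) = residueScalarHom (φ ≫ s) y c := by
  have h := congrArg (fun ψ => ψ.hom (scalarHom s (φ y) c)) (Scheme.residue_residueFieldMap φ y)
  simp only [CommRingCat.hom_comp, RingHom.comp_apply] at h
  refine h.trans ?_
  exact congrArg (Y.residue y).hom (stalkMap_scalarHom φ s y c)

theorem scalarHom_comp_specMap {K : Type u} [Field K] {X : Scheme.{u}} (s : X ⟶ Spec (.of K))
    (θ : k →+* K) (x : X) (c : k) :
    scalarHom (s ≫ Spec.map (CommRingCat.ofHom θ)) x c = scalarHom s x (θ c) := by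
  have h := congrArg (fun ψ => ψ.hom c) (Scheme.ΓSpecIso_inv_naturality (CommRingCat.ofHom θ))
  simp only [CommRingCat.hom_comp, RingHom.comp_apply] at h
  simp only [scalarHom, CommRingCat.hom_comp, RingHom.comp_apply, Scheme.Hom.comp_appTop]
  exact congrArg _ (congrArg _ h.symm)

theorem residueScalarHom_comp_specMap {K : Type u} [Field K] {X : Scheme.{u}}
    (s : X ⟶ Spec (.of K)) (θ : k →+* K) (x : X) (c : k) :
    residueScalarHom (s ≫ Spec.map (CommRingCat.ofHom θ)) x c = residueScalarHom s x (θ c) :=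
  congrArg (X.residue x).hom (scalarHom_comp_specMap s θ x c)

theorem fromSpecResidueField_comp {X : Scheme.{u}} (s : X ⟶ Spec (.of k)) (x : X) :
    X.fromSpecResidueField x ≫ s = Spec.map (CommRingCat.ofHom (residueScalarHom s x)) := by
  have h : X.fromSpecStalk x ≫ s = Spec.map (CommRingCat.ofHom (scalarHom s x)) := by
    apply ext_of_isAffine
    rw [← cancel_epi (Scheme.ΓSpecIso (.of k)).inv, ← Scheme.ΓSpecIso_inv_naturality,
      Scheme.Hom.comp_appTop, Scheme.fromSpecStalk_appTop]
    simp [scalarHom]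
  rw [Scheme.fromSpecResidueField, Category.assoc, h, ← Spec.map_comp]
  rfl

theorem scalarHom_id_surjective {K : Type u} [Field K] (x : (Spec (.of K) : Scheme.{u})) :
    Function.Surjective (scalarHom (𝟙 (Spec (.of K))) x) := by
  intro u
  obtain ⟨a, b, hb, h⟩ := exists_germ_mul_eq (isAffineOpen_top (Spec (.of K)))
    (TopologicalSpace.Opens.mem_top x) u
  let e := (Scheme.ΓSpecIso (.of K)).commRingCatIsoToRingEquiv
  have hs (c : K) : scalarHom (𝟙 (Spec (.of K))) x c =
      (Spec (.of K)).presheaf.germ ⊤ x (TopologicalSpace.Opens.mem_top x) (e.symm c) := by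
    simp only [scalarHom, Scheme.Hom.id_appTop, Category.id_comp, CommRingCat.hom_comp,
      RingHom.comp_apply]
    rfl
  have hb0 : e b ≠ 0 := by
    intro h0
    rw [map_eq_zero_iff _ e.injective] at h0
    rw [h0, map_zero] at hb
    exact not_isUnit_zero hb
  refine ⟨e a / e b, hb.mul_right_cancel ?_⟩
  rw [h, ← e.symm_apply_apply b, ← hs, ← map_mul, e.symm_apply_apply, ← e.symm_apply_apply a, ← hs,
    div_mul_cancel₀ _ hb0, e.symm_apply_apply]

theorem bijective_residueScalarHom_id {K : Type u} [Field K] (x : (Spec (.of K) : Scheme.{u})) :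
    Function.Bijective (residueScalarHom (𝟙 (Spec (.of K))) x) := by
  refine ⟨(residueScalarHom (𝟙 (Spec (.of K))) x).injective, fun z => ?_⟩
  obtain ⟨u, rfl⟩ := (Spec (.of K)).residue_surjective x z
  obtain ⟨c, rfl⟩ := scalarHom_id_surjective x u
  exact ⟨c, rfl⟩

theorem maximalIdeal_stalk_spec_field {K : Type u} [Field K] (x : (Spec (.of K) : Scheme.{u})) :
    IsLocalRing.maximalIdeal ((Spec (.of K)).presheaf.stalk x) = ⊥ := by
  rw [eq_bot_iff]
  intro u hu
  obtain ⟨c, rfl⟩ := scalarHom_id_surjective x u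
  by_cases hc : c = 0
  · simp [hc]
  · exact absurd ((isUnit_iff_ne_zero.mpr hc).map (scalarHom (𝟙 (Spec (.of K))) x)) hu

/-- A point through which a section passes is rational. -/
theorem isRational_of_section {K : Type u} [Field K] {F : Scheme.{u}} (s : F ⟶ Spec (.of K))
    (τ : Spec (.of K) ⟶ F) (h : τ ≫ s = 𝟙 _) (x : (Spec (.of K) : Scheme.{u})) :
    Function.Bijective (residueScalarHom s (τ x)) := by
  refine ⟨(residueScalarHom s (τ x)).injective, fun z => ?_⟩
  obtain ⟨c, hc⟩ := (bijective_residueScalarHom_id x).2 (τ.residueFieldMap x z)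
  refine ⟨c, (τ.residueFieldMap x).hom.injective ?_⟩
  rw [← hc, ← h]
  exact residueFieldMap_residueScalarHom τ s x c

end Scalars

/-! ### Local rings, residue fields and rational points of a fibre. -/

section Fiber

variable {X C : Scheme.{u}} (π : X ⟶ C) (y : C)

/-- The structure morphism of a fibre. -/
abbrev fiberStr : π.fiber y ⟶ Spec (.of (C.residueField y)) := π.fiberToSpecResidueField y

theorem fiberι_apply (x : π.fiber y) : π (π.fiberι y x) = y := by
  have : π.fiberι y x ∈ π ⁻¹' {y} := by
    rw [← π.range_fiberι y]; exact ⟨x, rfl⟩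
  exact this

theorem exists_fiberι_eq {x : X} (h : π x = y) : ∃ z : π.fiber y, π.fiberι y z = x := by
  have : x ∈ Set.range (π.fiberι y) := by rw [π.range_fiberι y]; exact h
  exact this

theorem fiberι_stalkMap_surjective (x : π.fiber y) :
    Function.Surjective ((π.fiberι y).stalkMap x) :=
  (π.fiberι y).stalkMap_surjective x

/-- Put `A = 𝒪_{X,x} / 𝔪_y 𝒪_{X,x}`. The morphism `Spec A ⟶ X` lands over `Spec κ(y)`, so by the
universal property it factors through the fibre. A germ that dies on the fibre therefore dies in
`A`. -/
theorem fiberι_stalkMap_ker (x : π.fiber y) (u : X.presheaf.stalk (π.fiberι y x))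
    (hu : (π.fiberι y).stalkMap x u = 0) :
    u ∈ (IsLocalRing.maximalIdeal (C.presheaf.stalk (π (π.fiberι y x)))).map
      (π.stalkMap (π.fiberι y x)).hom := by
  obtain ⟨U, hU, σ, rfl⟩ := X.presheaf.exists_germ_eq u
  rw [Scheme.Hom.germ_stalkMap_apply] at hu
  set x' := π.fiberι y x with hx'
  set I := (IsLocalRing.maximalIdeal (C.presheaf.stalk (π x'))).map (π.stalkMap x').hom with hI
  have hIle : I ≤ IsLocalRing.maximalIdeal (X.presheaf.stalk x') :=
    map_maximalIdeal_le (π.stalkMap x').hom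
  have hnt : Nontrivial (X.presheaf.stalk x' ⧸ I) :=
    Ideal.Quotient.nontrivial_iff.mpr fun h =>
      (IsLocalRing.maximalIdeal.isMaximal (X.presheaf.stalk x')).ne_top (top_le_iff.mp (h ▸ hIle))
  have hloc : IsLocalRing (X.presheaf.stalk x' ⧸ I) :=
    IsLocalRing.of_surjective' (Ideal.Quotient.mk I) Ideal.Quotient.mk_surjective
  let A : CommRingCat.{u} := .of (X.presheaf.stalk x' ⧸ I)
  have hlocA : IsLocalRing A := hloc
  let m : X.presheaf.stalk x' ⟶ A := CommRingCat.ofHom (Ideal.Quotient.mk I)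
  have hm : IsLocalHom m.hom :=
    IsLocalHom.of_surjective (Ideal.Quotient.mk I) Ideal.Quotient.mk_surjective
  let a : Spec A ⟶ X := Spec.map m ≫ X.fromSpecStalk x'
  -- The equality `π x' = y` is not definitional, so the base point is a variable that can be
  -- substituted. The same device is used for the points and morphisms in `hu'` and `h1` below.
  have hb : ∀ y', π x' = y' → ∃ b : Spec A ⟶ Spec (C.residueField y'),
      a ≫ π = b ≫ C.fromSpecResidueField y' := by
    rintro _ rfl
    have hker : ∀ r ∈ IsLocalRing.maximalIdeal (C.presheaf.stalk (π x')),
        (π.stalkMap x' ≫ m).hom r = 0 := fun r hr =>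
      Ideal.Quotient.eq_zero_iff_mem.mpr (Ideal.mem_map_of_mem _ hr)
    let l : C.residueField (π x') ⟶ A := CommRingCat.ofHom (Ideal.Quotient.lift _ _ hker)
    refine ⟨Spec.map l, ?_⟩
    rw [Scheme.fromSpecResidueField, ← Spec.map_comp_assoc]
    have hl : C.residue (π x') ≫ l = π.stalkMap x' ≫ m := by
      ext r
      exact Ideal.Quotient.lift_mk _ _ hker
    rw [hl, Spec.map_comp, Category.assoc, Category.assoc, Scheme.SpecMap_stalkMap_fromSpecStalk]
  obtain ⟨b, hab⟩ := hb y (fiberι_apply π y x)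
  let l : Spec A ⟶ π.fiber y := Limits.pullback.lift a b hab
  have hl : l ≫ π.fiberι y = a := Limits.pullback.lift_fst _ _ _
  have ha : a (IsLocalRing.closedPoint A) = x' := by
    refine (Scheme.Hom.comp_apply _ _ _).trans ((congrArg _ ?_).trans
      Scheme.fromSpecStalk_closedPoint)
    exact Spec_closedPoint
  have hlx : l (IsLocalRing.closedPoint A) = x := by
    apply (π.fiberι y).isEmbedding.injective
    exact (Scheme.Hom.comp_apply _ _ _).symm.trans ((congrArg (fun f : Spec A ⟶ X =>
      f (IsLocalRing.closedPoint A)) hl).trans ha)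
  have hu' : ∀ z, z = x → ∀ hz, (π.fiber y).presheaf.germ (π.fiberι y ⁻¹ᵁ U) z hz
      ((π.fiberι y).app U σ) = 0 := by
    rintro _ rfl _
    exact hu
  have h1 : ∀ f, f = l ≫ π.fiberι y → ∀ hf, Scheme.stalkClosedPointTo f
      (X.presheaf.germ U (f (IsLocalRing.closedPoint A)) hf σ) = 0 := by
    rintro _ rfl hf
    rw [Scheme.stalkClosedPointTo_comp]
    have h := ((π.fiberι y).germ_stalkMap_apply U (l (IsLocalRing.closedPoint A)) hf σ).trans
      (hu' _ hlx hf)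
    exact (congrArg (Scheme.stalkClosedPointTo l) h).trans (map_zero _)
  have hU' : a (IsLocalRing.closedPoint A) ∈ U := by rw [ha]; exact hU
  have h2 := h1 a hl.symm hU'
  have h3 := congrArg (fun ψ => ψ.hom σ)
    (Scheme.germ_stalkClosedPointTo_Spec_fromSpecStalk m U hU')
  have h4 : m (X.presheaf.germ U x' hU σ) = 0 := h3.symm.trans h2
  exact Ideal.Quotient.eq_zero_iff_mem.mp h4

/-- The stalk map passes through a local ring of `Spec K`, whose maximal ideal is zero. -/
theorem stalkMap_eq_zero_of_fac {F : Scheme.{u}} {K : Type u} [Field K] {f : F ⟶ C}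
    {p : F ⟶ Spec (.of K)} {r : Spec (.of K) ⟶ C} (h : f = p ≫ r) (x : F)
    (a : C.presheaf.stalk (f x)) (ha : a ∈ IsLocalRing.maximalIdeal (C.presheaf.stalk (f x))) :
    f.stalkMap x a = 0 := by
  subst h
  have h1 : r.stalkMap (p x) a ∈
      IsLocalRing.maximalIdeal ((Spec (.of K)).presheaf.stalk (p x)) :=
    map_maximalIdeal_le (r.stalkMap (p x)).hom (Ideal.mem_map_of_mem _ ha)
  rw [maximalIdeal_stalk_spec_field, Ideal.mem_bot] at h1
  rw [Scheme.Hom.stalkMap_comp]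
  exact (congrArg (p.stalkMap x) h1).trans (map_zero _)

theorem fiberι_stalkMap_eq_zero (x : π.fiber y) (a : C.presheaf.stalk (π (π.fiberι y x)))
    (ha : a ∈ IsLocalRing.maximalIdeal (C.presheaf.stalk (π (π.fiberι y x)))) :
    (π.fiberι y).stalkMap x (π.stalkMap (π.fiberι y x) a) = 0 := by
  have h := stalkMap_eq_zero_of_fac (f := π.fiberι y ≫ π) (p := fiberStr π y) (π.fiber_fac y) x a ha
  rw [Scheme.Hom.stalkMap_comp] at h
  exact h

variable {k : Type u} [Field k] {strX : X ⟶ Spec (.of k)} {strC : C ⟶ Spec (.of k)}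

theorem residueScalarHom_fiberι (hπ : π ≫ strC = strX) (x : π.fiber y) (c : k) :
    (π.fiberι y).residueFieldMap x (residueScalarHom strX (π.fiberι y x) c) =
      residueScalarHom (fiberStr π y) x (residueScalarHom strC y c) := by
  rw [residueFieldMap_residueScalarHom, ← hπ, ← Category.assoc, π.fiber_fac, Category.assoc,
    fromSpecResidueField_comp]
  exact residueScalarHom_comp_specMap (fiberStr π y) _ x c

theorem bijective_fiberι_residueFieldMap (x : π.fiber y) :
    Function.Bijective ((π.fiberι y).residueFieldMap x) := by
  refine ⟨((π.fiberι y).residueFieldMap x).hom.injective, fun z => ?_⟩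
  obtain ⟨u, rfl⟩ := (π.fiber y).residue_surjective x z
  obtain ⟨v, rfl⟩ := fiberι_stalkMap_surjective π y x u
  exact ⟨X.residue _ v, congrArg (fun ψ => ψ.hom v)
    (Scheme.residue_residueFieldMap (π.fiberι y) x)⟩

theorem isRational_of_isRational_image (hπ : π ≫ strC = strX) (x : X)
    (hx : Function.Bijective (residueScalarHom strX x)) :
    Function.Bijective (residueScalarHom strC (π x)) := by
  refine ⟨(residueScalarHom strC (π x)).injective, fun z => ?_⟩
  obtain ⟨c, hc⟩ := hx.2 (π.residueFieldMap x z)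
  refine ⟨c, (π.residueFieldMap x).hom.injective ?_⟩
  rw [← hc, ← hπ]
  exact residueFieldMap_residueScalarHom π strC x c

/-- Passing to the fibre does not change the residue field at `x`, and `κ(y) = k` for rational `y`.
-/
theorem isRational_fiberι_iff (hπ : π ≫ strC = strX)
    (hy : Function.Bijective (residueScalarHom strC y)) (x : π.fiber y) :
    Function.Bijective (residueScalarHom strX (π.fiberι y x)) ↔
      Function.Bijective (residueScalarHom (fiberStr π y) x) := by
  have h : ((π.fiberι y).residueFieldMap x) ∘ (residueScalarHom strX (π.fiberι y x)) =
      residueScalarHom (fiberStr π y) x ∘ residueScalarHom strC y :=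
    funext fun c => residueScalarHom_fiberι π y hπ x c
  rw [← (bijective_fiberι_residueFieldMap π y x).of_comp_iff', h, hy.of_comp_iff]

/-- The rational points of `X` over a rational point `y` are those of the fibre. -/
def fiberRationalPoint (hπ : π ≫ strC = strX)
    (hy : Function.Bijective (residueScalarHom strC y)) :
    RationalPoint (fiberStr π y) ≃ {P : RationalPoint strX // π P.1 = y} :=
  Equiv.ofBijective
    (fun x => ⟨⟨π.fiberι y x.1, (isRational_fiberι_iff π y hπ hy x.1).mpr x.2⟩,
      fiberι_apply π y x.1⟩) <| by
    constructor
    · intro x x' h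
      apply Subtype.ext
      exact (π.fiberι y).isEmbedding.injective
        (congrArg (fun P : {P : RationalPoint strX // π P.1 = y} => P.1.1) h)
    · rintro ⟨⟨P, hP⟩, hPy⟩
      obtain ⟨z, rfl⟩ := exists_fiberι_eq π y hPy
      exact ⟨⟨z, (isRational_fiberι_iff π y hπ hy z).mp hP⟩, rfl⟩

end Fiber

/-! ### Function fields and local rings of a ruled surface -/

theorem algebraMap_stalkSpecializes {X : Scheme.{u}} [IsIntegral X] {x y : X} (h : x ⤳ y)
    (u : X.presheaf.stalk y) :
    algebraMap (X.presheaf.stalk x) X.functionField (X.presheaf.stalkSpecializes h u) =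
      algebraMap (X.presheaf.stalk y) X.functionField u :=
  X.presheaf.stalkSpecializes_comp_apply ((genericPoint_spec X).specializes trivial) h u

theorem maximalIdeal_genericPoint {X : Scheme.{u}} [IsIntegral X] :
    IsLocalRing.maximalIdeal (X.presheaf.stalk (genericPoint X)) = ⊥ :=
  IsLocalRing.isField_iff_maximalIdeal_eq.mp (Field.toIsField X.functionField)

theorem exists_isClosed_specializes (C : Scheme.{u}) [CompactSpace C] (y : C) :
    ∃ p : C, IsClosed ({p} : Set C) ∧ y ⤳ p := by
  obtain ⟨p, hp, hp'⟩ := IsClosed.exists_closed_singleton (isClosed_closure (s := {y}))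
    ⟨y, subset_closure rfl⟩
  exact ⟨p, hp', specializes_iff_mem_closure.mpr hp⟩

/-- If the maximal ideal at `p` is principal, generizations of `p` are `p` or generic. -/
theorem eq_or_eq_genericPoint_of_specializes {C : Scheme.{u}} [IsIntegral C] {p y : C}
    [IsNoetherianRing (C.presheaf.stalk p)] (h : y ⤳ p)
    (hp : (IsLocalRing.maximalIdeal (C.presheaf.stalk p)).IsPrincipal) :
    y = p ∨ y = genericPoint C := by
  have hy : y ∈ Set.range (C.fromSpecStalk p) := by rw [Scheme.range_fromSpecStalk]; exact h
  have hg : genericPoint C ∈ Set.range (C.fromSpecStalk p) := by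
    rw [Scheme.range_fromSpecStalk]; exact (genericPoint_spec C).specializes trivial
  obtain ⟨Q, rfl⟩ := hy
  obtain ⟨G, hG⟩ := hg
  -- A Noetherian local domain with principal maximal ideal is a principal ideal ring, so its only
  -- primes are zero and the maximal ideal.
  have hPIR : IsPrincipalIdealRing (C.presheaf.stalk p) :=
    ((tfae_of_isNoetherianRing_of_isLocalRing_of_isDomain (C.presheaf.stalk p)).out 0 4).mpr hp
  by_cases hQ : Q.asIdeal = ⊥
  · right
    have h1 : Q ⤳ G := (PrimeSpectrum.le_iff_specializes _ _).mp (by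
      change Q.asIdeal ≤ G.asIdeal; rw [hQ]; exact bot_le)
    have h2 := h1.map (C.fromSpecStalk p).continuous
    rw [hG] at h2
    exact (h2.antisymm ((genericPoint_spec C).specializes trivial)).eq
  · left
    have hprime := Q.2
    have hmax := IsPrime.to_maximal_ideal hQ
    have : Q = IsLocalRing.closedPoint (C.presheaf.stalk p) :=
      PrimeSpectrum.ext (IsLocalRing.eq_maximalIdeal hmax)
    rw [this]
    exact Scheme.fromSpecStalk_closedPoint

/-- By Zariski's lemma `B` is a finite extension of the finite field `A`, hence separable. Its
differentials vanish, whereas relative dimension one requires them to have rank one. -/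
theorem not_isStandardSmoothOfRelativeDimension_one {A B : Type*} [CommRing A] [CommRing B]
    (hA : IsField A) (hB : IsField B) [Finite A] (φ : A →+* B) :
    ¬ φ.IsStandardSmoothOfRelativeDimension 1 := by
  intro h
  let _ := hA.toField
  let _ := hB.toField
  let _ := φ.toAlgebra
  have h' : Algebra.IsStandardSmoothOfRelativeDimension 1 A B := h
  have hs : Algebra.IsStandardSmooth A B := h'.isStandardSmooth
  have hf : Module.Finite A B := finite_of_finite_type_of_isJacobsonRing A B
  have hu : Algebra.FormallyUnramified A B := Algebra.FormallyUnramified.of_isSeparable A B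
  have hr := Algebra.IsStandardSmoothOfRelativeDimension.rank_kaehlerDifferential (R := A)
    (S := B) 1
  rw [rank_subsingleton'] at hr
  simp at hr

/-- Otherwise `C` is a single point with a field as coordinate ring, which is not smooth of relative
dimension one over `k`. This makes uniformizers nonzero. -/
theorem not_isClosed_genericPoint {k : Type u} [Field k] [Finite k] {C : Scheme.{u}} [IsIntegral C]
    (s : C ⟶ Spec (.of k)) [hs : SmoothOfRelativeDimension 1 s] :
    ¬ IsClosed ({genericPoint C} : Set C) := by
  intro h
  have hsub : Subsingleton C := by
    have h1 := h.closure_eq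
    rw [(genericPoint_spec C).def] at h1
    exact Set.subsingleton_univ_iff.mp (h1 ▸ Set.subsingleton_singleton)
  obtain ⟨U, -, V, -, hV, hUV, hsm⟩ := hs.exists_isStandardSmoothOfRelativeDimension (genericPoint C)
  have hV' : V = ⊤ := top_le_iff.mp fun y _ => Subsingleton.elim (genericPoint C) y ▸ hV
  have hU' : U = ⊤ := top_le_iff.mp fun y _ => by
    have h1 : s (genericPoint C) ∈ U := hUV hV
    have h2 : Subsingleton (PrimeSpectrum k) := inferInstance
    exact h2.elim (s (genericPoint C)) y ▸ h1
  subst hV' hU'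
  let ε : Γ(Spec (.of k), ⊤) ≃+* k := (Scheme.ΓSpecIso (.of k)).commRingCatIsoToRingEquiv
  have hfin : Finite Γ(Spec (.of k), ⊤) := Finite.of_equiv k ε.symm.toEquiv
  exact not_isStandardSmoothOfRelativeDimension_one (ε.toMulEquiv.isField (Field.toIsField k))
    (isField_of_isIntegral_of_subsingleton C) _ hsm

theorem maximalIdeal_ne_bot {C : Scheme.{u}} [IsIntegral C] {p : C}
    (hp : p ≠ genericPoint C) : IsLocalRing.maximalIdeal (C.presheaf.stalk p) ≠ ⊥ := by
  intro h
  have hg : genericPoint C ∈ Set.range (C.fromSpecStalk p) := by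
    rw [Scheme.range_fromSpecStalk]; exact (genericPoint_spec C).specializes trivial
  obtain ⟨G, hG⟩ := hg
  apply hp
  rw [← hG]
  have : G = IsLocalRing.closedPoint (C.presheaf.stalk p) := PrimeSpectrum.ext <|
    le_antisymm (IsLocalRing.le_maximalIdeal G.2.ne_top) (by
      change IsLocalRing.maximalIdeal _ ≤ _; rw [h]; exact bot_le)
  rw [this]
  exact Scheme.fromSpecStalk_closedPoint.symm

namespace RuledSurface

variable {k : Type u} [Field k] (R : RuledSurface k)

instance : LocallyOfFiniteType R.strX := R.properX.toLocallyOfFiniteType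

instance : LocallyOfFiniteType R.strC := R.properC.toLocallyOfFiniteType

instance : QuasiCompact R.strC := by
  have := R.properC
  infer_instance

instance : IsLocallyNoetherian R.X := LocallyOfFiniteType.isLocallyNoetherian R.strX

instance : IsLocallyNoetherian R.C := LocallyOfFiniteType.isLocallyNoetherian R.strC

instance : CompactSpace R.C := QuasiCompact.compactSpace_of_compactSpace R.strC

theorem π_σ (y : R.C) : R.π (R.σ y) = y := by
  rw [← Scheme.Hom.comp_apply, R.σ_π]; rfl

theorem π_genericPoint : R.π (genericPoint R.X) = genericPoint R.C := by
  have h : IsGenericPoint (R.π (genericPoint R.X)) (closure (R.π '' ⊤)) :=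
    (genericPoint_spec R.X).image R.π.continuous
  have h2 : R.π '' ⊤ = ⊤ := by
    rw [Set.top_eq_univ, Set.image_univ]
    exact Set.range_eq_univ.mpr fun y => ⟨R.σ y, R.π_σ y⟩
  rw [h2, Set.top_eq_univ, closure_univ] at h
  exact h.eq (genericPoint_spec R.C)

/-- The inclusion `K(C) ⊆ K(X)` of function fields. -/
def pb : R.C.functionField →+* R.X.functionField :=
  (R.π.stalkMap (genericPoint R.X)).hom.comp
    (R.C.presheaf.stalkSpecializes (specializes_of_eq R.π_genericPoint)).hom

theorem pb_algebraMap (x : R.X) (a : R.C.presheaf.stalk (R.π x)) :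
    R.pb (algebraMap _ R.C.functionField a) =
      algebraMap _ R.X.functionField (R.π.stalkMap x a) := by
  have h : genericPoint R.X ⤳ x := (genericPoint_spec R.X).specializes trivial
  have h1 := congrArg (fun ψ => ψ.hom a) (R.π.stalkSpecializes_stalkMap _ _ h)
  refine Eq.trans ?_ h1
  refine congrArg (R.π.stalkMap (genericPoint R.X)).hom ?_
  exact R.C.presheaf.stalkSpecializes_comp_apply _ _ _

/-- The maximal ideals of the local rings of `C` at closed points are principal. -/
def HasUniformizers : Prop :=
  ∀ p : R.C, IsClosed ({p} : Set R.C) →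
    (IsLocalRing.maximalIdeal (R.C.presheaf.stalk p)).IsPrincipal

/-- The local equations of the divisor `𝔡` on `C` already contain a generator of the maximal ideal
at every closed point. -/
theorem SelfIntersection.hasUniformizers {R : RuledSurface k} {m : ℤ} (h : R.SelfIntersection m) :
    R.HasUniformizers := by
  obtain ⟨r, 𝔡, -, h⟩ := h
  intro p hp
  obtain ⟨g, u, v, -, -, -, -, w, ϖ, hϖ, -⟩ := h p hp
  exact ⟨ϖ, hϖ.symm⟩

variable {R}

theorem HasUniformizers.eq_genericPoint (hU : R.HasUniformizers) {y : R.C}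
    (hy : ¬ IsClosed ({y} : Set R.C)) : y = genericPoint R.C := by
  obtain ⟨p, hp, hyp⟩ := exists_isClosed_specializes R.C y
  rcases eq_or_eq_genericPoint_of_specializes hyp (hU p hp) with rfl | h
  · exact absurd hp hy
  · exact h

theorem HasUniformizers.exists_span_eq (hU : R.HasUniformizers) (y : R.C) :
    ∃ ϖ : R.C.presheaf.stalk y,
      Ideal.span {ϖ} = IsLocalRing.maximalIdeal (R.C.presheaf.stalk y) := by
  by_cases hy : IsClosed ({y} : Set R.C)
  · obtain ⟨ϖ, h⟩ := hU y hy
    exact ⟨ϖ, h.symm⟩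
  · obtain rfl := hU.eq_genericPoint hy
    -- At the generic point the generator is `0`. It only ever occurs with exponent `coeff 𝔟 = 0` in
    -- a divisor's equation, where `0 ^ 0 = 1`.
    exact ⟨0, by rw [maximalIdeal_genericPoint]; simp⟩

theorem uniformizer_ne_zero [Finite k] {p : R.C} (hp : IsClosed ({p} : Set R.C))
    {ϖ : R.C.presheaf.stalk p}
    (hϖ : Ideal.span {ϖ} = IsLocalRing.maximalIdeal (R.C.presheaf.stalk p)) : ϖ ≠ 0 := by
  rintro rfl
  have := R.smoothC
  refine maximalIdeal_ne_bot (p := p) ?_ (by rw [← hϖ]; simp)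
  rintro rfl
  exact not_isClosed_genericPoint R.strC hp

end RuledSurface

/-! ### The ideal of the section, and local equations -/

theorem exists_unit_of_span_eq {A : Type*} [CommRing A] [IsDomain A] {g g' : A}
    (h : Ideal.span {g} = Ideal.span {g'}) : ∃ w : Aˣ, g * w = g' :=
  Ideal.span_singleton_eq_span_singleton.mp h

namespace RuledSurface

variable {k : Type u} [Field k] (R : RuledSurface k)

theorem σ_over : R.σ ≫ R.strX = R.strC := by
  rw [← R.π_over, ← Category.assoc, R.σ_π, Category.id_comp]

theorem isClosed_range_σ : IsClosed (Set.range R.σ) := by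
  have := R.properX
  have := R.properC
  have : IsProper (R.σ ≫ R.strX) := by rw [R.σ_over]; infer_instance
  have : IsProper R.σ := IsProper.of_comp R.σ R.strX
  exact R.σ.isClosedMap.isClosed_range

theorem idealC₀_eq_top {x : R.X} (hx : x ∉ Set.range R.σ) : R.idealC₀ x = ⊤ := by
  rw [Ideal.eq_top_iff_one]
  let U : R.X.Opens := ⟨(Set.range R.σ)ᶜ, R.isClosed_range_σ.isOpen_compl⟩
  refine Ideal.subset_span ⟨U, hx, 1, ?_, map_one _⟩
  have hU : R.σ ⁻¹ᵁ U = ⊥ := by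
    ext y
    simp [U]
  have : Subsingleton Γ(R.C, R.σ ⁻¹ᵁ U) := by
    rw [hU]; infer_instance
  exact Subsingleton.elim _ _

theorem mem_idealC₀_iff (y : R.C) (u : R.X.presheaf.stalk (R.σ y)) :
    u ∈ R.idealC₀ (R.σ y) ↔ R.σ.stalkMap y u = 0 := by
  constructor
  · intro h
    suffices R.idealC₀ (R.σ y) ≤ RingHom.ker (R.σ.stalkMap y).hom from this h
    refine Ideal.span_le.mpr ?_
    rintro _ ⟨U, hx, a, ha, rfl⟩
    change R.σ.stalkMap y _ = 0
    rw [Scheme.Hom.germ_stalkMap_apply, ha, map_zero]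
  · intro h
    obtain ⟨U, hU, a, rfl⟩ := R.X.presheaf.exists_germ_eq u
    rw [Scheme.Hom.germ_stalkMap_apply] at h
    refine Ideal.subset_span ⟨U, hU, a, ?_, rfl⟩
    have : Nonempty (R.σ ⁻¹ᵁ U) := ⟨⟨y, hU⟩⟩
    exact (map_eq_zero_iff _ (germ_injective_of_isIntegral R.C y hU)).mp h

theorem bijective_σ_π (y : R.C) :
    Function.Bijective fun a => R.σ.stalkMap y (R.π.stalkMap (R.σ y) a) := by
  have h1 : IsIso (R.σ ≫ R.π) := by rw [R.σ_π]; infer_instance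
  have h2 := ConcreteCategory.bijective_of_isIso ((R.σ ≫ R.π).stalkMap y)
  rw [Scheme.Hom.stalkMap_comp] at h2
  exact h2

variable {R}

/-- Since `σ` is a section, restriction to `C₀` maps the functions pulled back from `C`
isomorphically onto the local ring of `C`. -/
theorem exists_sub_mem_idealC₀ {x : R.X} (hx : x ∈ Set.range R.σ) (u : R.X.presheaf.stalk x) :
    ∃ a, u - R.π.stalkMap x a ∈ R.idealC₀ x := by
  obtain ⟨y, rfl⟩ := hx
  obtain ⟨a, ha⟩ := (R.bijective_σ_π y).2 (R.σ.stalkMap y u)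
  exact ⟨a, by rw [mem_idealC₀_iff, map_sub, sub_eq_zero]; exact ha.symm⟩

theorem eq_zero_of_stalkMap_mem_idealC₀ {x : R.X} (hx : x ∈ Set.range R.σ)
    {a : R.C.presheaf.stalk (R.π x)} (ha : R.π.stalkMap x a ∈ R.idealC₀ x) : a = 0 := by
  obtain ⟨y, rfl⟩ := hx
  rw [mem_idealC₀_iff] at ha
  exact (R.bijective_σ_π y).1 (ha.trans (by simp))

theorem isPrime_idealC₀ {x : R.X} (hx : x ∈ Set.range R.σ) : (R.idealC₀ x).IsPrime := by
  obtain ⟨y, rfl⟩ := hx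
  have : R.idealC₀ (R.σ y) = RingHom.ker (R.σ.stalkMap y).hom :=
    Ideal.ext fun u => R.mem_idealC₀_iff y u
  rw [this]
  exact RingHom.ker_isPrime _

/-- Lift `γ` to `X` and correct the lift by a function from `C` so that it vanishes on `C₀`. The
correction is zero on the fibre, so the result `g` still restricts to `γ`. Any other `w` in the
ideal `I` of `C₀` is a multiple of `g` plus `ϖ d`; as `I` is prime and `ϖ ∉ I`, also `d ∈ I`. -/
theorem exists_span_eq_idealC₀_of_fiber {y : R.C} (z : R.π.fiber y)
    (hz : R.π.fiberι y z ∈ Set.range R.σ) {ϖ : R.C.presheaf.stalk (R.π (R.π.fiberι y z))}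
    (hϖ : Ideal.span {ϖ} = IsLocalRing.maximalIdeal _) (hϖ0 : ϖ ≠ 0)
    {γ : (R.π.fiber y).presheaf.stalk z} (hγ : Ideal.span {γ} = IsLocalRing.maximalIdeal _) :
    ∃ g, Ideal.span {g} = R.idealC₀ (R.π.fiberι y z) ∧ (R.π.fiberι y).stalkMap z g = γ := by
  have hprime := isPrime_idealC₀ hz
  have hle : R.idealC₀ (R.π.fiberι y z) ≤ IsLocalRing.maximalIdeal _ :=
    IsLocalRing.le_maximalIdeal hprime.ne_top
  have hγm : γ ∈ IsLocalRing.maximalIdeal _ := hγ ▸ Ideal.mem_span_singleton_self γ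
  obtain ⟨v, hv⟩ := fiberι_stalkMap_surjective R.π y z γ
  have hvm : v ∈ IsLocalRing.maximalIdeal (R.X.presheaf.stalk (R.π.fiberι y z)) := by
    rw [IsLocalRing.mem_maximalIdeal, mem_nonunits_iff]
    intro h
    exact hγm (hv ▸ h.map ((R.π.fiberι y).stalkMap z).hom)
  obtain ⟨a, ha⟩ := exists_sub_mem_idealC₀ hz v
  have hma : a ∈ IsLocalRing.maximalIdeal _ := by
    rw [IsLocalRing.mem_maximalIdeal, mem_nonunits_iff]
    intro h
    have h1 := Ideal.sub_mem _ hvm (hle ha)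
    rw [sub_sub_cancel] at h1
    exact h1 (h.map (R.π.stalkMap (R.π.fiberι y z)).hom)
  have hg : (R.π.fiberι y).stalkMap z (v - R.π.stalkMap (R.π.fiberι y z) a) = γ := by
    rw [map_sub, hv]
    exact (congrArg (γ - ·) (fiberι_stalkMap_eq_zero R.π y z a hma)).trans (sub_zero _)
  refine ⟨v - R.π.stalkMap (R.π.fiberι y z) a, le_antisymm ?_ ?_, hg⟩
  · rw [Ideal.span_singleton_le_iff_mem]
    exact ha
  set g := v - R.π.stalkMap (R.π.fiberι y z) a with hgdef
  -- Nakayama: it suffices that `I ⊆ (g) + 𝔪 I`.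
  refine Submodule.le_of_le_smul_of_le_jacobson_bot (I := IsLocalRing.maximalIdeal _)
    (IsNoetherian.noetherian _) (IsLocalRing.maximalIdeal_le_jacobson _) ?_
  intro w hw
  have h1 : (R.π.fiberι y).stalkMap z w ∈ Ideal.span {γ} := by
    rw [hγ]
    exact map_maximalIdeal_le ((R.π.fiberι y).stalkMap z).hom (Ideal.mem_map_of_mem _ (hle hw))
  obtain ⟨c', hc'⟩ := Ideal.mem_span_singleton'.mp h1
  obtain ⟨c, rfl⟩ := fiberι_stalkMap_surjective R.π y z c'
  have h2 : (R.π.fiberι y).stalkMap z (w - c * g) = 0 := by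
    rw [map_sub, map_mul, hg, hc', sub_self]
  have h3 := fiberι_stalkMap_ker R.π y z _ h2
  rw [← hϖ, Ideal.map_span, Set.image_singleton] at h3
  obtain ⟨d, hd⟩ := Ideal.mem_span_singleton'.mp h3
  have h4 : d ∈ R.idealC₀ (R.π.fiberι y z) := by
    have h5 : d * (R.π.stalkMap (R.π.fiberι y z)).hom ϖ ∈ R.idealC₀ (R.π.fiberι y z) := by
      rw [hd]; exact Ideal.sub_mem _ hw (Ideal.mul_mem_left _ _ ha)
    exact (hprime.mem_or_mem h5).resolve_right fun h => hϖ0 (eq_zero_of_stalkMap_mem_idealC₀ hz h)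
  have h6 : w = c * g + (R.π.stalkMap (R.π.fiberι y z)).hom ϖ * d := by rw [mul_comm _ d, hd]; ring
  rw [h6]
  refine Submodule.add_mem_sup (Ideal.mul_mem_left _ _ (Ideal.mem_span_singleton_self g)) ?_
  refine Submodule.smul_mem_smul ?_ h4
  exact map_maximalIdeal_le (R.π.stalkMap (R.π.fiberι y z)).hom
    (Ideal.mem_map_of_mem _ (hϖ ▸ Ideal.mem_span_singleton_self ϖ))

variable (R) in
/-- The point where the section meets a fibre, as a section of the fibre. -/
def fiberSection (y : R.C) : Spec (.of (R.C.residueField y)) ⟶ R.π.fiber y :=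
  Limits.pullback.lift (R.C.fromSpecResidueField y ≫ R.σ) (𝟙 _) (by
    rw [Category.assoc, R.σ_π, Category.comp_id]
    exact (Category.id_comp _).symm)

variable (R) in
/-- The rational point where the section meets a fibre. -/
def fiberPoint (y : R.C) : RationalPoint (fiberStr R.π y) :=
  ⟨R.fiberSection y (IsLocalRing.closedPoint (R.C.residueField y)),
    isRational_of_section (fiberStr R.π y) (R.fiberSection y) (Limits.pullback.lift_snd _ _ _) _⟩

theorem fiberι_fiberPoint (y : R.C) : R.π.fiberι y (R.fiberPoint y).1 = R.σ y := by
  have h : R.fiberSection y ≫ R.π.fiberι y = R.C.fromSpecResidueField y ≫ R.σ :=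
    Limits.pullback.lift_fst _ _ _
  refine (Scheme.Hom.comp_apply _ _ _).symm.trans ?_
  refine (congrArg (fun f : Spec (.of (R.C.residueField y)) ⟶ R.X =>
    f (IsLocalRing.closedPoint (R.C.residueField y))) h).trans ?_
  refine (Scheme.Hom.comp_apply _ _ _).trans (congrArg _ ?_)
  exact Scheme.fromSpecResidueField_apply y _

theorem exists_fiber_equation [Finite k] (hU : R.HasUniformizers) {y : R.C}
    (hy : IsClosed ({y} : Set R.C)) :
    ∃ g, Ideal.span {g} = R.idealC₀ (R.π.fiberι y (R.fiberPoint y).1) ∧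
      (R.π.fiberι y).stalkMap (R.fiberPoint y).1 g ≠ 0 ∧
      Ideal.span {(R.π.fiberι y).stalkMap (R.fiberPoint y).1 g} = IsLocalRing.maximalIdeal _ := by
  obtain ⟨D⟩ := nonempty_projLineCharts (R.fiber_projLine y hy)
  have := D.isIntegral
  obtain ⟨γ, hγ0, hγ⟩ := D.exists_span_eq_maximalIdeal (R.fiberPoint y)
  obtain ⟨ϖ, hϖ⟩ := hU.exists_span_eq (R.π (R.π.fiberι y (R.fiberPoint y).1))
  have hϖ0 : ϖ ≠ 0 := uniformizer_ne_zero (by rw [fiberι_apply]; exact hy) hϖ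
  obtain ⟨g, hg, hgγ⟩ := exists_span_eq_idealC₀_of_fiber (R.fiberPoint y).1
    ⟨y, (fiberι_fiberPoint y).symm⟩ hϖ hϖ0 hγ
  exact ⟨g, hg, hgγ ▸ hγ0, hgγ ▸ hγ⟩

theorem σ_stalkMap_stalkSpecializes {y p : R.C} (h : y ⤳ p) (u : R.X.presheaf.stalk (R.σ p)) :
    R.σ.stalkMap y (R.X.presheaf.stalkSpecializes (h.map R.σ.continuous) u) =
      R.C.presheaf.stalkSpecializes h (R.σ.stalkMap p u) :=
  congrArg (fun ψ => ψ.hom u) (R.σ.stalkSpecializes_stalkMap _ _ h)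

/-- A germ at `σ y` is a fraction of sections on an affine neighbourhood of `σ p`. If its numerator
vanishes on `C₀` near `σ y`, it does so near `σ p`, because `C` is integral. -/
theorem span_stalkSpecializes_eq_idealC₀ {y p : R.C} (h : y ⤳ p) {g : R.X.presheaf.stalk (R.σ p)}
    (hg : Ideal.span {g} = R.idealC₀ (R.σ p)) :
    Ideal.span {R.X.presheaf.stalkSpecializes (h.map R.σ.continuous) g} =
      R.idealC₀ (R.σ y) := by
  have hspec := h.map R.σ.continuous
  apply le_antisymm
  · rw [Ideal.span_singleton_le_iff_mem, mem_idealC₀_iff, σ_stalkMap_stalkSpecializes h,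
      (R.mem_idealC₀_iff p g).mp (hg ▸ Ideal.mem_span_singleton_self g), map_zero]
  · intro u hu
    obtain ⟨U, hU, hpU, -⟩ := exists_isAffineOpen_mem_and_subset (X := R.X) (x := R.σ p) (U := ⊤)
      trivial
    have hyU : R.σ y ∈ U := hspec.mem_open U.2 hpU
    obtain ⟨a, b, hb, hab⟩ := exists_germ_mul_eq hU hyU u
    have ha : R.X.presheaf.germ U (R.σ y) hyU a ∈ R.idealC₀ (R.σ y) :=
      hab ▸ Ideal.mul_mem_right _ _ hu
    have hs : R.X.presheaf.stalkSpecializes hspec (R.X.presheaf.germ U (R.σ p) hpU a) =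
        R.X.presheaf.germ U (R.σ y) hyU a := R.X.presheaf.germ_stalkSpecializes_apply hpU hspec a
    have hap : R.X.presheaf.germ U (R.σ p) hpU a ∈ R.idealC₀ (R.σ p) := by
      rw [mem_idealC₀_iff]
      rw [← hs, mem_idealC₀_iff, σ_stalkMap_stalkSpecializes h] at ha
      apply IsFractionRing.injective (R.C.presheaf.stalk p) R.C.functionField
      rw [← algebraMap_stalkSpecializes h, ha, map_zero, map_zero]
    rw [← hg] at hap
    obtain ⟨c, hc⟩ := Ideal.mem_span_singleton'.mp hap
    have hu' : u * R.X.presheaf.germ U (R.σ y) hyU b ∈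
        Ideal.span {R.X.presheaf.stalkSpecializes hspec g} := by
      rw [hab, ← hs, ← hc, map_mul]
      exact Ideal.mul_mem_left _ _ (Ideal.mem_span_singleton_self _)
    exact (Ideal.mul_unit_mem_iff_mem _ hb).mp hu'

/-- Off `C₀` the equation is `1`. On `C₀` it comes from the fibre through a closed point to which
`x` specializes. -/
theorem exists_span_eq_idealC₀ [Finite k] (hU : R.HasUniformizers) (x : R.X) :
    ∃ g, g ≠ 0 ∧ Ideal.span {g} = R.idealC₀ x := by
  by_cases hx : x ∈ Set.range R.σ
  · obtain ⟨y, rfl⟩ := hx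
    obtain ⟨p, hp, hyp⟩ := exists_isClosed_specializes R.C y
    have h : ∃ g : R.X.presheaf.stalk (R.σ p), g ≠ 0 ∧ Ideal.span {g} = R.idealC₀ (R.σ p) := by
      obtain ⟨g, hg, hg0, -⟩ := exists_fiber_equation hU hp
      rw [← fiberι_fiberPoint p]
      refine ⟨g, ?_, hg⟩
      rintro rfl
      exact hg0 (map_zero _)
    obtain ⟨g, hg0, hg⟩ := h
    refine ⟨_, fun h0 => hg0 ?_, span_stalkSpecializes_eq_idealC₀ hyp hg⟩
    apply IsFractionRing.injective (R.X.presheaf.stalk (R.σ p)) R.X.functionField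
    rw [← algebraMap_stalkSpecializes (hyp.map R.σ.continuous), h0, map_zero, map_zero]
  · exact ⟨1, one_ne_zero, by rw [idealC₀_eq_top R hx, Ideal.span_singleton_one]⟩

variable (R) in
/-- `f g ^ b (π^*ϖ) ^ n` is regular at `x`, for all local equations `g` of `C₀` at `x` and all
generators `ϖ` of the maximal ideal at `π x`. -/
def IsRegularAt (b n : ℤ) (x : R.X) (f : R.X.functionField) : Prop :=
  ∀ (g : R.X.presheaf.stalk x) (ϖ : R.C.presheaf.stalk (R.π x)), Ideal.span {g} = R.idealC₀ x →
    Ideal.span {ϖ} = IsLocalRing.maximalIdeal (R.C.presheaf.stalk (R.π x)) →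
    ∃ u, algebraMap (R.X.presheaf.stalk x) R.X.functionField u =
      f * algebraMap (R.X.presheaf.stalk x) R.X.functionField g ^ b *
        R.pb (algebraMap (R.C.presheaf.stalk (R.π x)) R.C.functionField ϖ) ^ n

/-- Two choices of `g`, and of `ϖ`, differ by units, so regularity need only be tested on one pair.
-/
theorem isRegularAt_of {b n : ℤ} {x : R.X} {f : R.X.functionField} {g : R.X.presheaf.stalk x}
    {ϖ : R.C.presheaf.stalk (R.π x)} (hg : Ideal.span {g} = R.idealC₀ x)
    (hϖ : Ideal.span {ϖ} = IsLocalRing.maximalIdeal (R.C.presheaf.stalk (R.π x)))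
    (u : R.X.presheaf.stalk x) (hu : algebraMap (R.X.presheaf.stalk x) R.X.functionField u =
      f * algebraMap (R.X.presheaf.stalk x) R.X.functionField g ^ b *
        R.pb (algebraMap (R.C.presheaf.stalk (R.π x)) R.C.functionField ϖ) ^ n) :
    R.IsRegularAt b n x f := by
  intro g' ϖ' hg' hϖ'
  obtain ⟨w, rfl⟩ := exists_unit_of_span_eq (hg.trans hg'.symm)
  obtain ⟨v, rfl⟩ := exists_unit_of_span_eq (hϖ.trans hϖ'.symm)
  let v' : (R.X.presheaf.stalk x)ˣ := Units.map (R.π.stalkMap x).hom v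
  refine ⟨u * (w ^ b : (R.X.presheaf.stalk x)ˣ) * (v' ^ n : (R.X.presheaf.stalk x)ˣ), ?_⟩
  have hv : R.pb (algebraMap (R.C.presheaf.stalk (R.π x)) R.C.functionField v) =
      algebraMap (R.X.presheaf.stalk x) R.X.functionField v' := R.pb_algebraMap x v
  simp only [map_mul, mul_zpow, hu, map_units_zpow, hv]
  ring

theorem mem_sections_iff {b : ℤ} {𝔟 : CurveDivisor R.C} {f : R.X.functionField} :
    f ∈ R.sections b 𝔟 ↔ ∀ x, R.IsRegularAt b (coeff 𝔟 (R.π x)) x f := by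
  constructor
  · intro h x g ϖ hg hϖ
    obtain ⟨u, hu⟩ := h x _ ⟨1, g, ϖ, hg, hϖ, rfl⟩
    refine ⟨u, hu.trans ?_⟩
    rw [R.pb_algebraMap, Units.val_one, map_one, one_mul, mul_assoc]
  · rintro h x _ ⟨w, g, ϖ, hg, hϖ, rfl⟩
    obtain ⟨u, hu⟩ := h x g ϖ hg hϖ
    refine ⟨u * w, ?_⟩
    rw [map_mul, hu, R.pb_algebraMap]
    ring

theorem exists_isLocalEquation [Finite k] (hU : R.HasUniformizers) (b : ℤ) (𝔟 : CurveDivisor R.C)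
    (x : R.X) : ∃ t, R.IsLocalEquation b 𝔟 x t := by
  obtain ⟨g, -, hg⟩ := exists_span_eq_idealC₀ hU x
  obtain ⟨ϖ, hϖ⟩ := hU.exists_span_eq (R.π x)
  exact ⟨_, 1, g, ϖ, hg, hϖ, rfl⟩

end RuledSurface

/-! ### Sections on a fibre -/

namespace RuledSurface

variable {k : Type u} [Field k] {R : RuledSurface k}

variable (R) in
/-- `f g ^ b (π^*ϖ) ^ n` is a unit at `x`, where `g` is a local equation of `C₀` at `x` and
`ϖ` generates the maximal ideal at `π x`. -/
def IsUnitAt (b n : ℤ) (x : R.X) (f : R.X.functionField) : Prop :=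
  ∃ (g : R.X.presheaf.stalk x) (ϖ : R.C.presheaf.stalk (R.π x)) (w : (R.X.presheaf.stalk x)ˣ),
    Ideal.span {g} = R.idealC₀ x ∧
    Ideal.span {ϖ} = IsLocalRing.maximalIdeal (R.C.presheaf.stalk (R.π x)) ∧
    algebraMap (R.X.presheaf.stalk x) R.X.functionField w =
      f * algebraMap (R.X.presheaf.stalk x) R.X.functionField g ^ b *
        R.pb (algebraMap (R.C.presheaf.stalk (R.π x)) R.C.functionField ϖ) ^ n

theorem IsUnitAt.isUnit {b : ℤ} {𝔟 : CurveDivisor R.C} {x : R.X} {f t : R.X.functionField}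
    (h : R.IsUnitAt b (coeff 𝔟 (R.π x)) x f) (ht : R.IsLocalEquation b 𝔟 x t)
    {u : R.X.presheaf.stalk x}
    (hu : algebraMap (R.X.presheaf.stalk x) R.X.functionField u = f * t) : IsUnit u := by
  obtain ⟨g, ϖ, w, hg, hϖ, hw⟩ := h
  obtain ⟨w', g', ϖ', hg', hϖ', rfl⟩ := ht
  obtain ⟨v, rfl⟩ := exists_unit_of_span_eq (hg.trans hg'.symm)
  obtain ⟨v', rfl⟩ := exists_unit_of_span_eq (hϖ.trans hϖ'.symm)
  let v'' : (R.X.presheaf.stalk x)ˣ := Units.map (R.π.stalkMap x).hom v'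
  have hv : algebraMap (R.X.presheaf.stalk x) R.X.functionField (R.π.stalkMap x v') =
      algebraMap (R.X.presheaf.stalk x) R.X.functionField v'' := rfl
  have : u = (w * w' * v ^ b * v'' ^ coeff 𝔟 (R.π x) : (R.X.presheaf.stalk x)ˣ) := by
    apply IsFractionRing.injective (R.X.presheaf.stalk x) R.X.functionField
    rw [R.pb_algebraMap] at hw
    rw [hu]
    simp only [Units.val_mul, map_mul, mul_zpow, map_units_zpow, hv, hw]
    ring
  rw [this]
  exact Units.isUnit _

/-- Points such as `π (σ p)` and `p` are only propositionally equal; the common function field is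
where their uniformizers can be compared. -/
theorem exists_uniformizer_transport {y : R.C} {ϖ : R.C.presheaf.stalk y}
    (hϖ : Ideal.span {ϖ} = IsLocalRing.maximalIdeal _) {y' : R.C} (h : y' = y) :
    ∃ ϖ' : R.C.presheaf.stalk y', Ideal.span {ϖ'} = IsLocalRing.maximalIdeal _ ∧
      algebraMap _ R.C.functionField ϖ' = algebraMap _ R.C.functionField ϖ := by
  subst h
  exact ⟨ϖ, hϖ, rfl⟩

theorem algebraMap_fiberι_stalkMap {y : R.C} [IsIntegral (R.π.fiber y)] (z : R.π.fiber y)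
    (u : R.X.presheaf.stalk (R.π.fiberι y z)) :
    algebraMap _ (R.π.fiber y).functionField ((R.π.fiberι y).stalkMap z u) =
      (R.π.fiberι y).stalkMap (genericPoint (R.π.fiber y))
        (R.X.presheaf.stalkSpecializes ((((genericPoint_spec (R.π.fiber y)).specializes
          trivial : genericPoint (R.π.fiber y) ⤳ z)).map (R.π.fiberι y).continuous) u) :=
  (congrArg (fun ψ => ψ.hom u) ((R.π.fiberι y).stalkSpecializes_stalkMap _ _
    ((genericPoint_spec (R.π.fiber y)).specializes trivial))).symm

/-- A section of `𝒪_X(b C₀ + n π^*y)` near the fibre over `y` that does not vanish along the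
fibre has at most `b` zeros among the rational points of the fibre; in particular `b ≥ 0`. -/
theorem encard_fiber_zeros_le [Finite k] (hU : R.HasUniformizers) {y : R.C}
    (hy : IsClosed ({y} : Set R.C)) {b n : ℤ} {f : R.X.functionField}
    (hf : ∀ x, R.π x = y → R.IsRegularAt b n x f)
    (hf' : ¬ ∀ x, R.π x = y → R.IsRegularAt b (n - 1) x f) :
    0 ≤ b ∧ {z : RationalPoint (fiberStr R.π y) |
      ¬ R.IsUnitAt b n (R.π.fiberι y z.1) f}.encard ≤ b.toNat := by
  obtain ⟨D⟩ := nonempty_projLineCharts (R.fiber_projLine y hy)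
  have hint := D.isIntegral
  obtain ⟨g, hg, hg0, hgm⟩ := exists_fiber_equation hU hy
  obtain ⟨ϖ, hϖ⟩ := hU.exists_span_eq y
  have hϖ0 : ϖ ≠ 0 := uniformizer_ne_zero hy hϖ
  set T : R.X.functionField := R.pb (algebraMap _ R.C.functionField ϖ) with hT
  have hT0 : T ≠ 0 := by
    rw [hT, map_ne_zero, map_ne_zero_iff _ (IsFractionRing.injective _ _)]
    exact hϖ0
  have htrans (z : R.π.fiber y) := exists_uniformizer_transport hϖ (fiberι_apply R.π y z)
  choose ϖ' hϖ' hϖT using htrans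
  -- One family of equations of `C₀` along the fibre: `g` where `C₀` meets it and `1` elsewhere. The
  -- stalk depends on `z`, hence the heterogeneous equality.
  have heq (z : R.π.fiber y) : ∃ g' : R.X.presheaf.stalk (R.π.fiberι y z),
      Ideal.span {g'} = R.idealC₀ _ ∧ (z ≠ (R.fiberPoint y).1 → g' = 1) ∧
        (z = (R.fiberPoint y).1 → HEq g' g) := by
    by_cases hz : z = (R.fiberPoint y).1
    · subst hz
      exact ⟨g, hg, fun h => absurd rfl h, fun _ => HEq.rfl⟩
    · refine ⟨1, ?_, fun _ => rfl, fun h => absurd h hz⟩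
      rw [idealC₀_eq_top, Ideal.span_singleton_one]
      rintro ⟨y', hy'⟩
      apply hz
      apply (R.π.fiberι y).isEmbedding.injective
      have h1 : y' = y := by rw [← fiberι_apply R.π y z, ← hy', R.π_σ]
      rw [← hy', h1]
      exact (fiberι_fiberPoint y).symm
  choose G hG hG1 hG2 using heq
  have hGz : G (R.fiberPoint y).1 = g := eq_of_heq (hG2 _ rfl)
  have hreg (z : R.π.fiber y) := hf _ (fiberι_apply R.π y z) (G z) (ϖ' z) (hG z) (hϖ' z)
  choose u hu using hreg
  simp only [hϖT, ← hT] at hu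
  let ξ := genericPoint (R.π.fiber y)
  have hξz (z : R.π.fiber y) : ξ ⤳ z := (genericPoint_spec (R.π.fiber y)).specializes trivial
  have hξ : ξ ≠ (R.fiberPoint y).1 := by
    intro h
    have h1 : IsLocalRing.maximalIdeal ((R.π.fiber y).presheaf.stalk (R.fiberPoint y).1) = ⊥ := by
      rw [← h]; exact maximalIdeal_genericPoint
    rw [← hgm, Ideal.span_singleton_eq_bot] at h1
    exact hg0 h1
  let ψ : (R.π.fiber y).functionField := (R.π.fiberι y).stalkMap ξ (u ξ)
  have hne (z : R.π.fiber y) (hz : z ≠ (R.fiberPoint y).1) :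
      algebraMap _ (R.π.fiber y).functionField ((R.π.fiberι y).stalkMap z (u z)) = ψ := by
    rw [algebraMap_fiberι_stalkMap]
    refine congrArg ((R.π.fiberι y).stalkMap ξ) ?_
    apply IsFractionRing.injective (R.X.presheaf.stalk (R.π.fiberι y ξ)) R.X.functionField
    rw [algebraMap_stalkSpecializes, hu, hu, hG1 z hz, hG1 ξ hξ, map_one, map_one]
  have hz₀' : algebraMap _ (R.π.fiber y).functionField
      ((R.π.fiberι y).stalkMap (R.fiberPoint y).1 (u (R.fiberPoint y).1)) =
      ψ * algebraMap _ (R.π.fiber y).functionField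
        ((R.π.fiberι y).stalkMap (R.fiberPoint y).1 g) ^ b := by
    let g' := R.X.presheaf.stalkSpecializes
      ((hξz (R.fiberPoint y).1).map (R.π.fiberι y).continuous) g
    have hg' : (R.π.fiberι y).stalkMap ξ g' =
        algebraMap _ (R.π.fiber y).functionField ((R.π.fiberι y).stalkMap (R.fiberPoint y).1 g) :=
      (algebraMap_fiberι_stalkMap (R.fiberPoint y).1 g).symm
    -- `C₀` does not contain the fibre: its equation is nonzero at the generic point of the fibre,
    -- and the stalk map is local.
    have hunit : IsUnit g' := by
      apply isUnit_of_map_unit ((R.π.fiberι y).stalkMap ξ).hom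
      have h0 : ((R.π.fiberι y).stalkMap ξ g' : (R.π.fiber y).functionField) ≠ 0 := by
        rw [hg', map_ne_zero_iff _ (IsFractionRing.injective _ _)]
        exact hg0
      exact isUnit_iff_ne_zero.mpr h0
    obtain ⟨w, hw⟩ := hunit
    have h1 : R.X.presheaf.stalkSpecializes ((hξz (R.fiberPoint y).1).map (R.π.fiberι y).continuous)
        (u (R.fiberPoint y).1) = u ξ * (w ^ b : (R.X.presheaf.stalk (R.π.fiberι y ξ))ˣ) := by
      apply IsFractionRing.injective (R.X.presheaf.stalk (R.π.fiberι y ξ)) R.X.functionField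
      rw [algebraMap_stalkSpecializes, map_mul, hu, hu, hGz, hG1 ξ hξ, map_one, one_zpow,
        map_units_zpow, hw, algebraMap_stalkSpecializes]
      ring
    rw [algebraMap_fiberι_stalkMap]
    refine (congrArg ((R.π.fiberι y).stalkMap ξ) h1).trans ?_
    rw [map_mul]
    refine congrArg (ψ * ·) ?_
    refine (map_units_zpow (L := (R.π.fiber y).functionField)
      ((R.π.fiberι y).stalkMap ξ).hom w b).trans ?_
    rw [← hg', ← hw]
  -- If the restriction were zero, every germ `u z` would be divisible by the uniformizer of the
  -- base, so the exponent `n` could be lowered, against `hf'`.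
  have hψ : ψ ≠ 0 := by
    intro h0
    apply hf'
    intro x hx
    obtain ⟨z, rfl⟩ := exists_fiberι_eq R.π y hx
    have h1 : (R.π.fiberι y).stalkMap z (u z) = 0 := by
      apply IsFractionRing.injective _ (R.π.fiber y).functionField
      rw [map_zero]
      by_cases hz : z = (R.fiberPoint y).1
      · subst hz
        rw [hz₀', h0, zero_mul]
      · rw [hne z hz, h0]
    have h2 := fiberι_stalkMap_ker R.π y z _ h1
    rw [← hϖ' z, Ideal.map_span, Set.image_singleton] at h2
    obtain ⟨d, hd⟩ := Ideal.mem_span_singleton'.mp h2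
    refine isRegularAt_of (hG z) (hϖ' z) d ?_
    have h3 := congrArg (algebraMap _ R.X.functionField) hd
    rw [map_mul, hu] at h3
    have h4 : algebraMap _ R.X.functionField ((R.π.stalkMap (R.π.fiberι y z)).hom (ϖ' z)) = T := by
      rw [hT, ← hϖT z]
      exact (R.pb_algebraMap _ _).symm
    rw [h4] at h3
    rw [hϖT, ← hT, zpow_sub_one₀ hT0, ← mul_assoc, ← h3, mul_inv_cancel_right₀ hT0]
  obtain ⟨hb, hle⟩ := D.zeros_le (R.fiberPoint y) _ hgm ψ hψ b
    (fun z => (R.π.fiberι y).stalkMap z (u z)) hne hz₀'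
  refine ⟨hb, le_trans (Set.encard_le_encard ?_) hle⟩
  intro z hz h
  apply hz
  obtain ⟨w, hw⟩ := isUnit_of_map_unit ((R.π.fiberι y).stalkMap z.1).hom _ h
  refine ⟨G z.1, ϖ' z.1, w, hG _, hϖ' _, ?_⟩
  rw [hw, hu, hϖT]

/-- By Krull's intersection theorem a nonzero germ is divisible by only finitely many powers of the
uniformizer of the base. -/
theorem exists_lower_bound_isRegularAt [Finite k] (hU : R.HasUniformizers) {x : R.X}
    (hx : IsClosed ({R.π x} : Set R.C)) {b : ℤ} {f : R.X.functionField} (hf0 : f ≠ 0) :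
    ∃ m : ℤ, ∀ n, R.IsRegularAt b n x f → m ≤ n := by
  by_cases hN : ∃ N, R.IsRegularAt b N x f
  swap
  · exact ⟨0, fun n hn => absurd ⟨n, hn⟩ hN⟩
  obtain ⟨N, hN⟩ := hN
  obtain ⟨g, hg0, hg⟩ := exists_span_eq_idealC₀ hU x
  obtain ⟨ϖ, hϖ⟩ := hU.exists_span_eq (R.π x)
  have hϖ0 : ϖ ≠ 0 := uniformizer_ne_zero hx hϖ
  have hT0 : R.pb (algebraMap _ R.C.functionField ϖ) ≠ 0 := by
    rw [map_ne_zero, map_ne_zero_iff _ (IsFractionRing.injective _ _)]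
    exact hϖ0
  obtain ⟨u, hu⟩ := hN g ϖ hg hϖ
  have hu0 : u ≠ 0 := by
    rintro rfl
    rw [map_zero] at hu
    refine mul_ne_zero (mul_ne_zero hf0 (zpow_ne_zero _ ?_)) (zpow_ne_zero _ hT0) hu.symm
    rw [map_ne_zero_iff _ (IsFractionRing.injective _ _)]
    exact hg0
  have hkrull := Ideal.iInf_pow_eq_bot_of_isLocalRing
    (IsLocalRing.maximalIdeal (R.X.presheaf.stalk x)) (IsLocalRing.maximalIdeal.isMaximal _).ne_top
  have hj : ∃ j : ℕ, u ∉ IsLocalRing.maximalIdeal (R.X.presheaf.stalk x) ^ j := by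
    by_contra! h
    exact hu0 ((Submodule.mem_bot _).mp (hkrull ▸ (Submodule.mem_iInf _).mpr h))
  obtain ⟨j, hj⟩ := hj
  refine ⟨N - j, fun n hn => ?_⟩
  by_contra! hlt
  obtain ⟨v, hv⟩ := hn g ϖ hg hϖ
  apply hj
  have huv : u = v * R.π.stalkMap x ϖ ^ (N - n).toNat := by
    apply IsFractionRing.injective (R.X.presheaf.stalk x) R.X.functionField
    rw [map_mul, hu, hv, map_pow, ← R.pb_algebraMap, mul_assoc (f * _), ← zpow_natCast,
      ← zpow_add₀ hT0]
    congr 2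
    omega
  rw [huv]
  refine Ideal.mul_mem_left _ _ (Ideal.pow_le_pow_right (by omega : j ≤ (N - n).toNat) ?_)
  refine Ideal.pow_mem_pow ?_ _
  exact map_maximalIdeal_le (R.π.stalkMap x).hom
    (Ideal.mem_map_of_mem _ (hϖ ▸ Ideal.mem_span_singleton_self ϖ))

/-- Divide `f` by the highest power of one fibre along which it vanishes. The restriction to that
fibre is a nonzero section of `𝒪(b)` on a projective line. -/
theorem nonneg_of_mem_sections [Finite k] (hU : R.HasUniformizers) {b : ℤ} {𝔟 : CurveDivisor R.C}
    {f : R.X.functionField} (hf : f ∈ R.sections b 𝔟) (hf0 : f ≠ 0) : 0 ≤ b := by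
  obtain ⟨y, hy, -⟩ := exists_isClosed_specializes R.C (genericPoint R.C)
  have hy' : IsClosed ({R.π (R.σ y)} : Set R.C) := by rw [R.π_σ]; exact hy
  obtain ⟨m, hm⟩ := exists_lower_bound_isRegularAt hU hy' (b := b) hf0
  obtain ⟨n, hn, hmin⟩ := Int.exists_least_of_bdd
    (P := fun n => ∀ x, R.π x = y → R.IsRegularAt b n x f)
    ⟨m, fun n hn => hm n (hn _ (R.π_σ y))⟩
    ⟨coeff 𝔟 y, by rintro x rfl; exact mem_sections_iff.mp hf x⟩
  refine (encard_fiber_zeros_le hU hy hn fun h => ?_).1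
  have := hmin _ h
  omega

end RuledSurface

/-! ### Restriction to the section, and the degree of effective divisors -/

namespace RuledSurface

variable {k : Type u} [Field k] {R : RuledSurface k}

/-- The morphism is a variable so that `h` can be substituted; it is applied to `σ ≫ π`. -/
theorem algebraMap_stalkMap_of_eq_id {C : Scheme.{u}} [IsIntegral C] {φ : C ⟶ C} (h : φ = 𝟙 C)
    (p : C) (a : C.presheaf.stalk (φ p)) :
    algebraMap _ C.functionField (φ.stalkMap p a) = algebraMap _ C.functionField a := by
  subst h
  rw [Scheme.Hom.stalkMap_id]
  rfl

theorem algebraMap_σ_π (p : R.C) (a : R.C.presheaf.stalk (R.π (R.σ p))) :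
    algebraMap _ R.C.functionField (R.σ.stalkMap p (R.π.stalkMap (R.σ p) a)) =
      algebraMap _ R.C.functionField a := by
  have h := algebraMap_stalkMap_of_eq_id R.σ_π p a
  rw [Scheme.Hom.stalkMap_comp] at h
  exact h

variable (R) in
/-- The rational function `φ` on `X` is regular at the generic point of `C₀`, and restricts to the
rational function `φ'` on `C`. -/
def Restricts (φ : R.X.functionField) (φ' : R.C.functionField) : Prop :=
  ∃ w : R.X.presheaf.stalk (R.σ (genericPoint R.C)),
    algebraMap _ R.X.functionField w = φ ∧ R.σ.stalkMap (genericPoint R.C) w = φ'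

theorem restricts_algebraMap (p : R.C) (u : R.X.presheaf.stalk (R.σ p)) :
    R.Restricts (algebraMap _ _ u) (algebraMap _ _ (R.σ.stalkMap p u)) := by
  have h : genericPoint R.C ⤳ p := (genericPoint_spec R.C).specializes trivial
  exact ⟨R.X.presheaf.stalkSpecializes (h.map R.σ.continuous) u,
    algebraMap_stalkSpecializes _ _, σ_stalkMap_stalkSpecializes h u⟩

theorem restricts_pb (p : R.C) (a : R.C.presheaf.stalk (R.π (R.σ p))) :
    R.Restricts (R.pb (algebraMap _ _ a)) (algebraMap _ _ a) := by
  have h := restricts_algebraMap p (R.π.stalkMap (R.σ p) a)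
  rwa [algebraMap_σ_π, ← R.pb_algebraMap] at h

namespace Restricts

variable {φ ψ : R.X.functionField} {φ' ψ' : R.C.functionField}

theorem mul (h : R.Restricts φ φ') (h' : R.Restricts ψ ψ') :
    R.Restricts (φ * ψ) (φ' * ψ') := by
  obtain ⟨w, rfl, rfl⟩ := h
  obtain ⟨v, rfl, rfl⟩ := h'
  exact ⟨w * v, map_mul _ _ _, map_mul _ _ _⟩

theorem zpow (h : R.Restricts φ φ') (h0 : φ' ≠ 0) (n : ℤ) : R.Restricts (φ ^ n) (φ' ^ n) := by
  obtain ⟨w, rfl, rfl⟩ := h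
  obtain ⟨w, rfl⟩ := isUnit_of_map_unit (R.σ.stalkMap (genericPoint R.C)).hom w
    (isUnit_iff_ne_zero (G₀ := R.C.functionField).mpr h0)
  exact ⟨(w ^ n : (R.X.presheaf.stalk (R.σ (genericPoint R.C)))ˣ), map_units_zpow _ w n,
    map_units_zpow (L := R.C.functionField) (R.σ.stalkMap (genericPoint R.C)).hom w n⟩

theorem inv (h : R.Restricts φ φ') (h0 : φ' ≠ 0) : R.Restricts φ⁻¹ φ'⁻¹ := by
  simpa using h.zpow h0 (-1)

theorem unique (h : R.Restricts φ φ') (h' : R.Restricts φ ψ') : φ' = ψ' := by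
  obtain ⟨w, hw, rfl⟩ := h
  obtain ⟨v, hv, rfl⟩ := h'
  rw [IsFractionRing.injective _ R.X.functionField (hw.trans hv.symm)]

theorem ne_zero (h : R.Restricts φ φ') (h0 : φ' ≠ 0) : φ ≠ 0 := by
  obtain ⟨w, rfl, rfl⟩ := h
  rw [map_ne_zero_iff _ (IsFractionRing.injective _ _)]
  rintro rfl
  exact h0 (map_zero _)

end Restricts

/-- Regularity along `C₀` at a closed point implies regularity at the generic point of `C₀`. -/
theorem IsRegularAt.generic [Finite k] (hU : R.HasUniformizers) {p : R.C}
    (hp : IsClosed ({p} : Set R.C)) {b n : ℤ} {f : R.X.functionField}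
    (h : R.IsRegularAt b n (R.σ p) f) : R.IsRegularAt b 0 (R.σ (genericPoint R.C)) f := by
  obtain ⟨g, hg0, hg⟩ := exists_span_eq_idealC₀ hU (R.σ p)
  obtain ⟨ϖ, hϖ⟩ := hU.exists_span_eq (R.π (R.σ p))
  have hϖ0 : ϖ ≠ 0 := uniformizer_ne_zero (by rw [R.π_σ]; exact hp) hϖ
  obtain ⟨u, hu⟩ := h g ϖ hg hϖ
  have hs : genericPoint R.C ⤳ p := (genericPoint_spec R.C).specializes trivial
  have hr := restricts_pb p ϖ
  have hϖ' : algebraMap _ R.C.functionField ϖ ≠ 0 := by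
    rw [map_ne_zero_iff _ (IsFractionRing.injective _ _)]; exact hϖ0
  obtain ⟨w, hw, -⟩ := hr.zpow hϖ' (-n)
  -- The factor `ϖ ^ n` is a unit at the generic point of `C₀` and is absorbed in `w`; the generator
  -- `ϖ₁` there enters with exponent `0`.
  obtain ⟨ϖ₁, hϖ₁⟩ := hU.exists_span_eq (R.π (R.σ (genericPoint R.C)))
  refine isRegularAt_of (span_stalkSpecializes_eq_idealC₀ hs hg) hϖ₁
    (R.X.presheaf.stalkSpecializes (hs.map R.σ.continuous) u * w) ?_
  rw [map_mul, hw, algebraMap_stalkSpecializes, algebraMap_stalkSpecializes, hu, zpow_zero, mul_one,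
    zpow_neg, mul_inv_cancel_right₀]
  exact zpow_ne_zero _ (hr.ne_zero hϖ')

theorem coeff_add (𝔟 𝔠 : CurveDivisor R.C) (y : R.C) :
    coeff (𝔟 + 𝔠) y = coeff 𝔟 y + coeff 𝔠 y := by
  unfold coeff
  split_ifs
  · exact Finsupp.add_apply _ _ _
  · simp

theorem coeff_smul (c : ℤ) (𝔟 : CurveDivisor R.C) (y : R.C) :
    coeff (c • 𝔟) y = c * coeff 𝔟 y := by
  unfold coeff
  split_ifs
  · exact Finsupp.smul_apply _ _ _
  · simp

theorem coeff_genericPoint [Finite k] (𝔟 : CurveDivisor R.C) : coeff 𝔟 (genericPoint R.C) = 0 := by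
  have := R.smoothC
  exact dif_neg (not_isClosed_genericPoint R.strC)

theorem degree_add {C : Scheme.{u}} (s : C ⟶ Spec (.of k)) (𝔟 𝔠 : CurveDivisor C) :
    degree s (𝔟 + 𝔠) = degree s 𝔟 + degree s 𝔠 :=
  Finsupp.sum_add_index' (fun _ => zero_mul _) (fun _ _ _ => add_mul _ _ _)

theorem degree_smul {C : Scheme.{u}} (s : C ⟶ Spec (.of k)) (c : ℤ) (𝔟 : CurveDivisor C) :
    degree s (c • 𝔟) = c * degree s 𝔟 := by
  unfold degree
  rw [Finsupp.sum_smul_index' fun _ => zero_mul _, Finsupp.mul_sum]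
  simp only [smul_eq_mul, mul_assoc]

/-- A nonzero rational function on `C` with poles bounded by `𝔠` forces `deg 𝔠 ≥ 0`. -/
theorem IsNormalized.degree_nonneg [Finite k] (hR : R.IsNormalized) (hU : R.HasUniformizers)
    {𝔠 : CurveDivisor R.C} {φ : R.C.functionField} (hφ : φ ≠ 0)
    (h : ∀ p, IsClosed ({p} : Set R.C) → ∃ (ϖ a : R.C.presheaf.stalk p),
      Ideal.span {ϖ} = IsLocalRing.maximalIdeal _ ∧
      algebraMap _ R.C.functionField a = φ * algebraMap _ R.C.functionField ϖ ^ coeff 𝔠 p) :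
    0 ≤ degree R.strC 𝔠 := by
  by_contra! hneg
  have h0 := hR.2 𝔠 hneg
  -- `C₀` is effective, so the pullback of a section of `𝒪_C(𝔠)` is a section of `𝒪_X(C₀ + π^*𝔠)`:
  -- locally it gains the factor `g`.
  have hmem : R.pb φ ∈ R.sections 1 𝔠 := by
    rw [mem_sections_iff]
    intro x
    obtain ⟨g, -, hg⟩ := exists_span_eq_idealC₀ hU x
    have h1 : ∃ (ϖ a : R.C.presheaf.stalk (R.π x)),
        Ideal.span {ϖ} = IsLocalRing.maximalIdeal _ ∧
        algebraMap _ R.C.functionField a =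
          φ * algebraMap _ R.C.functionField ϖ ^ coeff 𝔠 (R.π x) := by
      by_cases hx : IsClosed ({R.π x} : Set R.C)
      · exact h _ hx
      · rw [hU.eq_genericPoint hx]
        refine ⟨0, φ, by rw [maximalIdeal_genericPoint]; simp, ?_⟩
        rw [coeff_genericPoint, zpow_zero, mul_one]
        exact congrArg (fun ψ => ψ.hom φ) (R.C.presheaf.stalkSpecializes_refl _)
    obtain ⟨ϖ, a, hϖ, ha⟩ := h1
    refine isRegularAt_of hg hϖ (R.π.stalkMap x a * g) ?_
    rw [map_mul, ← R.pb_algebraMap, ha, map_mul, map_zpow₀, zpow_one]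
    ring
  rw [h0, Submodule.mem_bot, map_eq_zero] at hmem
  exact hφ hmem

/-- Off `C₀` the exponent of its equation is irrelevant, so failure occurs on `C₀`. Failure at its
generic point forces failure at any closed point. -/
theorem exists_not_isRegularAt_σ [Finite k] (hU : R.HasUniformizers) {c : ℤ} {𝔟 : CurveDivisor R.C}
    {f : R.X.functionField} (hf : f ∈ R.sections c 𝔟) (hf' : f ∉ R.sections (c - 1) 𝔟) :
    ∃ p, IsClosed ({p} : Set R.C) ∧ ¬ R.IsRegularAt (c - 1) (coeff 𝔟 p) (R.σ p) f := by
  rw [mem_sections_iff] at hf hf'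
  push Not at hf'
  obtain ⟨x, hx⟩ := hf'
  have hxσ : x ∈ Set.range R.σ := by
    by_contra hn
    apply hx
    have h1 := R.idealC₀_eq_top hn
    obtain ⟨ϖ, hϖ⟩ := hU.exists_span_eq (R.π x)
    have hg : Ideal.span {1} = R.idealC₀ x := by rw [h1, Ideal.span_singleton_one]
    obtain ⟨u, hu⟩ := hf x 1 ϖ hg hϖ
    refine isRegularAt_of hg hϖ u ?_
    simpa using hu
  obtain ⟨y, rfl⟩ := hxσ
  rw [R.π_σ] at hx
  by_cases hy : IsClosed ({y} : Set R.C)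
  · exact ⟨y, hy, hx⟩
  · obtain rfl := hU.eq_genericPoint hy
    rw [coeff_genericPoint] at hx
    obtain ⟨p, hp, -⟩ := exists_isClosed_specializes R.C (genericPoint R.C)
    exact ⟨p, hp, fun h => hx (h.generic hU hp)⟩

/-- On a normalized ruled surface with `e ≥ 0`, a divisor `b C₀ + π^*𝔟` with a nonzero section has
`deg 𝔟 ≥ 0`. -/
theorem IsNormalized.degree_nonneg_of_mem_sections [Finite k] (hR : R.IsNormalized) {e : ℤ}
    (hRe : R.HasInvariant e) (he : 0 ≤ e) {b : ℤ} {𝔟 : CurveDivisor R.C} {f : R.X.functionField}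
    (hf : f ∈ R.sections b 𝔟) (hf0 : f ≠ 0) : 0 ≤ degree R.strC 𝔟 := by
  have hU : R.HasUniformizers := SelfIntersection.hasUniformizers hRe
  -- Minimality of `c` means that `f`, as a section of `𝒪_X(cC₀ + π^*𝔟)`, does not vanish along
  -- `C₀`.
  obtain ⟨c, hc, hmin⟩ := Int.exists_least_of_bdd (P := fun c => f ∈ R.sections c 𝔟)
    ⟨0, fun c hc => nonneg_of_mem_sections hU hc hf0⟩ ⟨b, hf⟩
  have hc0 : 0 ≤ c := nonneg_of_mem_sections hU hc hf0
  have hc' : f ∉ R.sections (c - 1) 𝔟 := fun h => by have := hmin _ h; omega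
  obtain ⟨r, 𝔡, h𝔡, hr⟩ := hRe
  -- The function `f r ^ (-c)` restricts to `C₀` with poles bounded by `𝔟 + c𝔡`, where `deg 𝔡 = -e`;
  -- the numerator `a` is nonzero wherever `f` cannot be divided by a further equation of `C₀`.
  have key (p : R.C) (hp : IsClosed ({p} : Set R.C)) :
      ∃ (ϖ a : R.C.presheaf.stalk p) (ε : R.C.functionField),
        Ideal.span {ϖ} = IsLocalRing.maximalIdeal _ ∧ ε ≠ 0 ∧
        ε = algebraMap _ R.C.functionField ϖ ^ coeff (𝔟 + c • 𝔡) p ∧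
        (¬ R.IsRegularAt (c - 1) (coeff 𝔟 p) (R.σ p) f → a ≠ 0) ∧
        R.Restricts (f * r ^ (-c)) (algebraMap _ R.C.functionField a * ε⁻¹) := by
    obtain ⟨g, u, v, hg, hguv, hu0, hv0, w, ϖ, hϖ, hw⟩ := hr p hp
    have hϖ0 : ϖ ≠ 0 := uniformizer_ne_zero hp hϖ
    have hinj := IsFractionRing.injective (R.C.presheaf.stalk p) R.C.functionField
    have hinjX := IsFractionRing.injective (R.X.presheaf.stalk (R.σ p)) R.X.functionField
    obtain ⟨ϖ', hϖ', hϖϖ'⟩ := exists_uniformizer_transport hϖ (R.π_σ p)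
    have hreg := mem_sections_iff.mp hc (R.σ p)
    rw [R.π_σ] at hreg
    obtain ⟨h, hh⟩ := hreg g ϖ' hg hϖ'
    set s := R.σ.stalkMap p h with hs
    have hT0 : algebraMap _ R.C.functionField ϖ ≠ 0 := (map_ne_zero_iff _ hinj).mpr hϖ0
    refine ⟨ϖ, s * (w ^ (-c) : (R.C.presheaf.stalk p)ˣ), _, hϖ, zpow_ne_zero _ hT0, rfl, ?_, ?_⟩
    · intro hns h0
      apply hns
      have hs0 : s = 0 := by simpa using h0
      have hmem := (R.mem_idealC₀_iff p h).mpr hs0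
      rw [← hg] at hmem
      obtain ⟨d, rfl⟩ := Ideal.mem_span_singleton'.mp hmem
      have hgne : algebraMap _ R.X.functionField g ≠ 0 := by
        obtain ⟨g', hg'0, hg'⟩ := exists_span_eq_idealC₀ hU (R.σ p)
        obtain ⟨ω, rfl⟩ := exists_unit_of_span_eq (hg'.trans hg.symm)
        rw [map_ne_zero_iff _ hinjX]
        exact mul_ne_zero hg'0 ω.ne_zero
      refine isRegularAt_of hg hϖ' d ?_
      rw [map_mul] at hh
      rw [zpow_sub_one₀ hgne]
      apply mul_right_cancel₀ hgne
      rw [hh]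
      field_simp
    · have hU1 := restricts_algebraMap p u
      have hV1 := restricts_algebraMap p v
      have hH1 := restricts_algebraMap p h
      have hP1 := restricts_pb p ϖ'
      rw [hϖϖ'] at hP1 hh
      have hu1 : algebraMap _ R.C.functionField (R.σ.stalkMap p u) ≠ 0 :=
        (map_ne_zero_iff _ hinj).mpr hu0
      have hv1 : algebraMap _ R.C.functionField (R.σ.stalkMap p v) ≠ 0 :=
        (map_ne_zero_iff _ hinj).mpr hv0
      have hQ := (hU1.mul (hV1.inv hv1)).zpow (mul_ne_zero hu1 (inv_ne_zero hv1)) (-c)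
      have hall := (hH1.mul (hP1.zpow hT0 (-coeff 𝔟 p))).mul hQ
      have hUne := hU1.ne_zero hu1
      have hVne := hV1.ne_zero hv1
      have hPne := hP1.ne_zero hT0
      have hgr : r * algebraMap _ R.X.functionField g ≠ 0 := by
        intro h0
        rw [h0, zero_mul] at hguv
        exact hUne hguv.symm
      obtain ⟨hr0, hg0⟩ := mul_ne_zero_iff.mp hgr
      -- From `h = f g ^ c ϖ ^ 𝔟(p)` and `r g = u / v`; each factor on the right can be restricted
      -- to `C₀`.
      have e1 : f * r ^ (-c) = algebraMap _ R.X.functionField h *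
          R.pb (algebraMap _ R.C.functionField ϖ) ^ (-coeff 𝔟 p) *
          (algebraMap _ R.X.functionField u * (algebraMap _ R.X.functionField v)⁻¹) ^ (-c) := by
        rw [← hguv, mul_inv_cancel_right₀ hVne, hh, mul_zpow, zpow_neg, zpow_neg, zpow_neg]
        have := zpow_ne_zero c hg0
        have := zpow_ne_zero (coeff 𝔟 p) hPne
        field_simp
      rw [e1]
      convert hall using 1
      rw [← div_eq_mul_inv (algebraMap _ R.C.functionField (R.σ.stalkMap p u)), hw, map_mul,
        map_units_zpow, mul_zpow, coeff_add, coeff_smul, ← zpow_neg, ← zpow_mul, neg_add,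
        zpow_add₀ hT0]
      rw [show -(c * coeff 𝔡 p) = coeff 𝔡 p * -c by ring]
      ring
  obtain ⟨p₀, hp₀, hns⟩ := exists_not_isRegularAt_σ hU hc hc'
  obtain ⟨ϖ₀, a₀, ε₀, -, hε₀, -, ha₀, hφ⟩ := key p₀ hp₀
  set φ := algebraMap _ R.C.functionField a₀ * ε₀⁻¹ with hφdef
  have hφ0 : φ ≠ 0 := by
    refine mul_ne_zero ?_ (inv_ne_zero hε₀)
    rw [map_ne_zero_iff _ (IsFractionRing.injective _ _)]
    exact ha₀ hns
  have hdeg := hR.degree_nonneg hU (𝔠 := 𝔟 + c • 𝔡) hφ0 fun p hp => by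
    obtain ⟨ϖ, a, ε, hϖ, hε, rfl, -, ha⟩ := key p hp
    refine ⟨ϖ, a, hϖ, ?_⟩
    -- The restrictions found at the various `p` are one function on `C`, since all restrict `f r ^
    -- (-c)`.
    rw [hφ.unique ha, inv_mul_cancel_right₀ hε]
  rw [degree_add, degree_smul, h𝔡] at hdeg
  have := mul_nonneg hc0 he
  linarith

end RuledSurface

/-! ### Rational points of a scheme of finite type over a finite field -/

section RationalPoints

variable {k : Type u} [Field k] {C : Scheme.{u}} (s : C ⟶ Spec (.of k))

/-- The composite `Spec κ(y) ⟶ C ⟶ Spec k` is an isomorphism and `s` is separated, so the first map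
is proper. -/
theorem isClosed_of_isRational [IsSeparated s] {y : C}
    (hy : Function.Bijective (residueScalarHom s y)) : IsClosed ({y} : Set C) := by
  have h1 : IsIso (CommRingCat.ofHom (residueScalarHom s y)) :=
    (ConcreteCategory.isIso_iff_bijective _).mpr hy
  have h2 : IsProper (C.fromSpecResidueField y ≫ s) := by
    rw [fromSpecResidueField_comp]
    infer_instance
  have h3 : IsProper (C.fromSpecResidueField y) := IsProper.of_comp _ s
  rw [← Scheme.range_fromSpecResidueField]
  exact (C.fromSpecResidueField y).isClosedMap.isClosed_range

theorem residueDegree_eq_one {y : C} (hy : Function.Bijective (residueScalarHom s y)) :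
    s.residueDegree y = 1 := by
  let _ := (s.residueFieldMap y).hom.toAlgebra
  have h : Function.Bijective (s.residueFieldMap y) := by
    refine ⟨(s.residueFieldMap y).hom.injective, fun z => ?_⟩
    obtain ⟨c, rfl⟩ := hy.2 z
    refine ⟨residueScalarHom (𝟙 _) (s y) c, ?_⟩
    rw [residueFieldMap_residueScalarHom, Category.comp_id]
  have e := LinearEquiv.ofBijective (Algebra.linearMap (((Spec (.of k)).residueField (s y)))
    (C.residueField y)) h
  exact e.symm.finrank_eq.trans (Module.finrank_self _)

theorem finiteType_sectionScalarHom [LocallyOfFiniteType s] {U : C.Opens} (hU : IsAffineOpen U) :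
    (sectionScalarHom s U).FiniteType := by
  have h := s.finiteType_appLE (isAffineOpen_top _) hU le_top
  have h2 : Function.Surjective (Scheme.ΓSpecIso (.of k)).inv.hom :=
    (ConcreteCategory.bijective_of_isIso (Scheme.ΓSpecIso (.of k)).inv).2
  exact h.comp (RingHom.FiniteType.of_surjective _ h2)

/-- A rational point is determined by the kernel of its evaluation map, and that map by its values
in `k` on finitely many generators. -/
theorem finite_rationalPoint_mem [Finite k] [LocallyOfFiniteType s] {U : C.Opens}
    (hU : IsAffineOpen U) : {P : RationalPoint s | P.1 ∈ U}.Finite := by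
  let _ := (sectionScalarHom s U).toAlgebra
  have hft : Algebra.FiniteType k Γ(C, U) := finiteType_sectionScalarHom s hU
  obtain ⟨S, hS⟩ := hft.1
  let ev (P : {P : RationalPoint s | P.1 ∈ U}) : Γ(C, U) →ₐ[k] k :=
    { (value s P.1).comp (C.presheaf.germ U P.1.1 P.2).hom with
      commutes' := fun c => by
        change value s P.1 (C.presheaf.germ U P.1.1 P.2 (sectionScalarHom s U c)) = c
        rw [germ_sectionScalarHom, value_scalarHom] }
  have hev (P : {P : RationalPoint s | P.1 ∈ U}) (a : Γ(C, U)) :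
      ev P a = 0 ↔ a ∈ (hU.primeIdealOf ⟨P.1.1, P.2⟩).asIdeal := by
    have h := isUnit_germ_iff hU P.2 a
    have h' := value_eq_zero_iff P.1 (C.presheaf.germ U P.1.1 P.2 a)
    rw [← not_iff_not, ← h]
    exact (not_congr h').trans not_not
  refine Finite.of_injective (β := S → k) (fun P a => ev P a.1) fun P Q h => ?_
  have hPQ : ev P = ev Q := AlgHom.ext_of_adjoin_eq_top hS fun a ha => congrFun h ⟨a, ha⟩
  have hprime : (hU.primeIdealOf ⟨P.1.1, P.2⟩).asIdeal = (hU.primeIdealOf ⟨Q.1.1, Q.2⟩).asIdeal :=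
    Ideal.ext fun a => by rw [← hev, ← hev, hPQ]
  apply Subtype.ext
  apply Subtype.ext
  exact ((specializes_of_primeIdealOf_le hU P.2 Q.2 (le_of_eq hprime)).antisymm
    (specializes_of_primeIdealOf_le hU Q.2 P.2 (le_of_eq hprime.symm))).eq

theorem finite_rationalPoint [Finite k] [LocallyOfFiniteType s] [CompactSpace C] :
    Finite (RationalPoint s) := by
  have h (x : C) := exists_isAffineOpen_mem_and_subset (X := C) (x := x) (U := ⊤) trivial
  choose U hU hxU _ using h
  obtain ⟨t, ht⟩ := isCompact_univ.elim_finite_subcover (fun x => (U x : Set C))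
    (fun x => (U x).2) fun x _ => Set.mem_iUnion.mpr ⟨x, hxU x⟩
  have hfin : (⋃ x ∈ t, {P : RationalPoint s | P.1 ∈ U x}).Finite :=
    t.finite_toSet.biUnion fun x _ => finite_rationalPoint_mem s (hU x)
  refine Set.finite_univ_iff.mp (hfin.subset fun P _ => ?_)
  simpa using ht (Set.mem_univ P.1)

end RationalPoints

/-! ### Counting zeros -/

namespace RuledSurface

variable {k : Type u} [Field k] {R : RuledSurface k}

variable (R) in
/-- The map `X(k) → C(k)`. -/
def rationalMap (P : RationalPoint R.strX) : RationalPoint R.strC :=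
  ⟨R.π P.1, isRational_of_isRational_image R.π R.π_over P.1 P.2⟩

theorem rationalMap_eq_iff {P : RationalPoint R.strX} {y : RationalPoint R.strC} :
    R.rationalMap P = y ↔ R.π P.1 = y.1 :=
  Subtype.ext_iff

theorem isClosed_rationalPoint (y : RationalPoint R.strC) : IsClosed ({y.1} : Set R.C) := by
  have := R.properC
  exact isClosed_of_isRational R.strC y.2

instance [Finite k] : Finite (RationalPoint R.strC) := finite_rationalPoint R.strC

theorem card_fiber_rationalMap [Finite k] (y : RationalPoint R.strC) :
    Finite {P : RationalPoint R.strX // R.rationalMap P = y} ∧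
    Nat.card {P : RationalPoint R.strX // R.rationalMap P = y} = Nat.card k + 1 := by
  obtain ⟨D⟩ := nonempty_projLineCharts (R.fiber_projLine y.1 (isClosed_rationalPoint y))
  let ε : k ≃ R.C.residueField y.1 := Equiv.ofBijective _ y.2
  have hfin : Finite (R.C.residueField y.1) := Finite.of_equiv k ε
  obtain ⟨h1, h2⟩ := ProjLineCharts.card_rationalPoint (K := R.C.residueField y.1) D
  let φ : RationalPoint (fiberStr R.π y.1) ≃
      {P : RationalPoint R.strX // R.rationalMap P = y} :=
    (fiberRationalPoint R.π y.1 R.π_over y.2).trans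
      (Equiv.subtypeEquivRight fun P => rationalMap_eq_iff.symm)
  exact ⟨@Finite.of_equiv _ _ h1 φ, (Nat.card_congr φ).symm.trans
    (h2.trans (congrArg (· + 1) (Nat.card_congr ε).symm))⟩

instance [Finite k] : Finite (RationalPoint R.strX) := by
  have h (y : RationalPoint R.strC) := (card_fiber_rationalMap y).1
  exact Finite.of_equiv _ (Equiv.sigmaFiberEquiv R.rationalMap)

theorem card_rationalPoint [Finite k] : Nat.card (RationalPoint R.strX) =
    Nat.card (RationalPoint R.strC) * (Nat.card k + 1) := by
  have := Fintype.ofFinite (RationalPoint R.strC)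
  have h (y : RationalPoint R.strC) := (card_fiber_rationalMap y).1
  rw [← Nat.card_congr (Equiv.sigmaFiberEquiv R.rationalMap), Nat.card_sigma,
    Finset.sum_congr rfl fun y _ => (card_fiber_rationalMap y).2, Finset.sum_const,
    Finset.card_univ, Nat.card_eq_fintype_card (α := RationalPoint R.strC), smul_eq_mul]

variable (R) in
/-- The rational points of `C` as closed points. -/
def closedPoint (y : RationalPoint R.strC) : ClosedPoint R.C := ⟨y.1, isClosed_rationalPoint y⟩

theorem closedPoint_injective : Function.Injective R.closedPoint := fun _ _ h =>
  Subtype.ext (congrArg (fun p : ClosedPoint R.C => p.1) h)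

variable (R) in
/-- The reduced divisor of a finite set of rational points of `C`. -/
def sumPoints (T : Finset (RationalPoint R.strC)) : CurveDivisor R.C :=
  ∑ y ∈ T, Finsupp.single (R.closedPoint y) 1

theorem degree_sumPoints (T : Finset (RationalPoint R.strC)) :
    degree R.strC (R.sumPoints T) = T.card := by
  classical
  induction T using Finset.induction_on with
  | empty => simp [sumPoints, degree]
  | insert y T hy ih =>
    rw [sumPoints, Finset.sum_insert hy, degree_add]
    have h1 : degree R.strC (Finsupp.single (R.closedPoint y) 1) = 1 := by
      rw [degree, Finsupp.sum_single_index (zero_mul _)]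
      have : R.strC.residueDegree (R.closedPoint y).1 = 1 := residueDegree_eq_one R.strC y.2
      rw [this]
      norm_num
    rw [h1, Finset.card_insert_of_notMem hy]
    rw [sumPoints] at ih
    rw [ih]
    push_cast
    ring

theorem sumPoints_apply_closedPoint {T : Finset (RationalPoint R.strC)} {y : RationalPoint R.strC}
    (hy : y ∈ T) : R.sumPoints T (R.closedPoint y) = 1 := by
  rw [sumPoints, Finsupp.finsetSum_apply, Finset.sum_eq_single y]
  · exact Finsupp.single_eq_same
  · intro z _ hzy
    exact Finsupp.single_eq_of_ne fun h => hzy (closedPoint_injective h.symm)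
  · exact fun h => absurd hy h

theorem sumPoints_apply_eq_zero {T : Finset (RationalPoint R.strC)} {p : ClosedPoint R.C}
    (hp : ∀ y ∈ T, R.closedPoint y ≠ p) : R.sumPoints T p = 0 := by
  rw [sumPoints, Finsupp.finsetSum_apply]
  exact Finset.sum_eq_zero fun y hy => Finsupp.single_eq_of_ne (hp y hy).symm

/-- A section that vanishes along the fibres over `T` is a section of `𝒪_X(b C₀ + π^*(𝔟 - T))`. -/
theorem mem_sections_sub_sumPoints {b : ℤ} {𝔟 : CurveDivisor R.C} {f : R.X.functionField}
    (hf : f ∈ R.sections b 𝔟) (T : Finset (RationalPoint R.strC))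
    (hT : ∀ y ∈ T, ∀ x, R.π x = y.1 → R.IsRegularAt b (coeff 𝔟 y.1 - 1) x f) :
    f ∈ R.sections b (𝔟 + (-1 : ℤ) • R.sumPoints T) := by
  rw [mem_sections_iff] at hf ⊢
  intro x
  rw [coeff_add, coeff_smul]
  by_cases hx : ∃ y ∈ T, y.1 = R.π x
  · obtain ⟨y, hy, hyx⟩ := hx
    have h1 : coeff (R.sumPoints T) y.1 = 1 :=
      (dif_pos (isClosed_rationalPoint y)).trans (sumPoints_apply_closedPoint hy)
    have h2 := hT y hy x hyx.symm
    rwa [← hyx, h1]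
  · have h1 : coeff (R.sumPoints T) (R.π x) = 0 := by
      unfold coeff
      split_ifs with hcl
      · exact sumPoints_apply_eq_zero fun y hy h => hx ⟨y, hy, congrArg Subtype.val h⟩
      · rfl
    rw [h1, mul_zero, add_zero]
    exact hf x

theorem Trivialization.not_isUnitAt {b : ℤ} {𝔟 : CurveDivisor R.C} (τ : R.Trivialization b 𝔟)
    (f : R.sections b 𝔟) {P : RationalPoint R.strX} (hP : τ.germMap f P = 0) :
    ¬ R.IsUnitAt b (coeff 𝔟 (R.π P.1)) P.1 f.1 := fun h =>
  (value_eq_zero_iff P (τ.germ P f)).mp hP (h.isUnit (τ.isLocalEquation P) (τ.algebraMap_germ P f))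

/-- The number of zeros of a nonzero section among the rational points of `X`. -/
theorem Trivialization.card_zeros_le [Finite k] (hR : R.IsNormalized) {e : ℤ}
    (hRe : R.HasInvariant e) (he : 0 ≤ e) {b : ℤ} {𝔟 : CurveDivisor R.C}
    (hb : b ≤ Nat.card k + 1) (τ : R.Trivialization b 𝔟) (f : R.sections b 𝔟) (hf : f ≠ 0) :
    (Nat.card {P // τ.germMap f P = 0} : ℤ) ≤ degree R.strC 𝔟 * (Nat.card k + 1) +
      (Nat.card (RationalPoint R.strC) - degree R.strC 𝔟) * b := by
  classical
  have hU : R.HasUniformizers := SelfIntersection.hasUniformizers hRe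
  have hf0 : f.1 ≠ 0 := fun h => hf (Subtype.ext h)
  have hb0 : 0 ≤ b := nonneg_of_mem_sections hU f.2 hf0
  have := Fintype.ofFinite (RationalPoint R.strC)
  have := Fintype.ofFinite (RationalPoint R.strX)
  -- The rational points over which `f` vanishes along the whole fibre.
  let T : Finset (RationalPoint R.strC) := Finset.univ.filter fun y =>
    ∀ x, R.π x = y.1 → R.IsRegularAt b (coeff 𝔟 y.1 - 1) x f.1
  have hT : (T.card : ℤ) ≤ degree R.strC 𝔟 := by
    have h1 := mem_sections_sub_sumPoints f.2 T fun y hy => (Finset.mem_filter.mp hy).2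
    have h2 := hR.degree_nonneg_of_mem_sections hRe he h1 hf0
    rw [degree_add, degree_smul, degree_sumPoints] at h2
    linarith
  let Z : Finset (RationalPoint R.strX) := Finset.univ.filter fun P => τ.germMap f P = 0
  have hZ : Nat.card {P // τ.germMap f P = 0} = Z.card := by
    rw [Nat.card_eq_fintype_card, Fintype.card_subtype]
  have hin (y : RationalPoint R.strC) :
      (Z.filter fun P => R.rationalMap P = y).card ≤ Nat.card k + 1 := by
    rw [← (card_fiber_rationalMap y).2, Nat.card_eq_fintype_card, Fintype.card_subtype]
    exact Finset.card_le_card (Finset.filter_subset_filter _ (Finset.subset_univ _))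
  have hout (y : RationalPoint R.strC) (hy : y ∉ T) :
      (Z.filter fun P => R.rationalMap P = y).card ≤ b.toNat := by
    have hreg : ∀ x, R.π x = y.1 → R.IsRegularAt b (coeff 𝔟 y.1) x f.1 := by
      intro x hx
      rw [← hx]
      exact mem_sections_iff.mp f.2 x
    have h1 := (encard_fiber_zeros_le hU (isClosed_rationalPoint y) hreg fun h =>
      hy (Finset.mem_filter.mpr ⟨Finset.mem_univ _, h⟩)).2
    have h2 : ((Z.filter fun P => R.rationalMap P = y : Finset _) : Set _) ⊆
        (fun z => (fiberRationalPoint R.π y.1 R.π_over y.2 z).1) ''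
          {z | ¬ R.IsUnitAt b (coeff 𝔟 y.1) (R.π.fiberι y.1 z.1) f.1} := by
      intro P hP
      obtain ⟨hPZ, hPy⟩ := Finset.mem_filter.mp (Finset.mem_coe.mp hP)
      have hPy' := rationalMap_eq_iff.mp hPy
      obtain ⟨z, hz⟩ := (fiberRationalPoint R.π y.1 R.π_over y.2).surjective ⟨P, hPy'⟩
      have hzP : (fiberRationalPoint R.π y.1 R.π_over y.2 z).1 = P := congrArg Subtype.val hz
      refine ⟨z, ?_, hzP⟩
      have h3 := τ.not_isUnitAt f (Finset.mem_filter.mp hPZ).2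
      rw [hPy'] at h3
      have h4 : R.π.fiberι y.1 z.1 = P.1 := congrArg Subtype.val hzP
      change ¬ R.IsUnitAt b (coeff 𝔟 y.1) (R.π.fiberι y.1 z.1) f.1
      rwa [h4]
    have h3 := ((Set.encard_le_encard h2).trans (Set.encard_image_le _ _)).trans h1
    rw [Set.encard_coe_eq_coe_finsetCard] at h3
    exact_mod_cast h3
  have hsum := Finset.card_eq_sum_card_fiberwise (s := Z) (t := Finset.univ) (f := R.rationalMap)
    fun _ _ => Finset.mem_coe.mpr (Finset.mem_univ _)
  have h5 : Z.card ≤ T.card * (Nat.card k + 1) + Tᶜ.card * b.toNat := by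
    rw [hsum, ← Finset.sum_add_sum_compl T]
    refine Nat.add_le_add ?_ ?_
    · exact (Finset.sum_le_card_nsmul _ _ _ fun y _ => hin y)
    · exact (Finset.sum_le_card_nsmul _ _ _ fun y hy => hout y (Finset.mem_compl.mp hy))
  rw [Finset.card_compl, ← Nat.card_eq_fintype_card] at h5
  have h6 : T.card ≤ Nat.card (RationalPoint R.strC) := by
    rw [Nat.card_eq_fintype_card]; exact Finset.card_le_univ T
  rw [hZ]
  zify [h6] at h5
  rw [Int.toNat_of_nonneg hb0] at h5
  -- Replacing `|T|` by `deg 𝔟` increases the bound by `(deg 𝔟 - |T|)(q + 1 - b) ≥ 0`.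
  nlinarith [mul_nonneg (sub_nonneg.mpr hT) (sub_nonneg.mpr hb)]

theorem Trivialization.le_encard_support [Finite k] (hR : R.IsNormalized) {e : ℤ}
    (hRe : R.HasInvariant e) (he : 0 ≤ e) {b : ℤ} {𝔟 : CurveDivisor R.C}
    (hb : b ≤ Nat.card k + 1) (τ : R.Trivialization b 𝔟) (f : R.sections b 𝔟) (hf : f ≠ 0) :
    (((Nat.card (RationalPoint R.strX) : ℤ) - degree R.strC 𝔟 * (Nat.card k + 1) -
      (Nat.card (RationalPoint R.strC) - degree R.strC 𝔟) * b).toNat : ℕ∞) ≤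
      {P | τ.germMap f P ≠ 0}.encard := by
  have h := τ.card_zeros_le hR hRe he hb f hf
  have h1 : Set.ncard {P | τ.germMap f P = 0} + Set.ncard {P | τ.germMap f P ≠ 0} =
      Nat.card (RationalPoint R.strX) := Set.ncard_add_ncard_compl _
  have h2 : Nat.card {P // τ.germMap f P = 0} = Set.ncard {P | τ.germMap f P = 0} := rfl
  rw [← Set.Finite.cast_ncard_eq (Set.toFinite _), Nat.cast_le]
  rw [h2] at h
  omega

end RuledSurface

end RuledCode

end

/-! ### Injectivity of evaluation and the distance bound. -/

theorem theorem4p9 {k : Type u} [Field k] [Finite k] (R : RuledCode.RuledSurface k)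
    (hR : R.IsNormalized) (e : ℤ) (hRe : R.HasInvariant e) (he : 0 ≤ e)
    (q a n : ℕ) (hq : q = Nat.card k) (ha : a = Nat.card (RuledCode.RationalPoint R.strC))
    (hn : n = Nat.card (RuledCode.RationalPoint R.strX))
    (b₁ b₂ : ℤ) (𝔟 : RuledCode.CurveDivisor R.C) (h𝔟 : RuledCode.degree R.strC 𝔟 = b₂)
    (hb₂ : b₂ < a) (hpos : 0 < (n : ℤ) - b₂ * (q + 1) - (a - b₂) * b₁) :
    Finite (RuledCode.RationalPoint R.strC) ∧ Finite (RuledCode.RationalPoint R.strX) ∧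
    n = a * (q + 1) ∧
    (∀ x : R.X, ∃ t : R.X.functionField, R.IsLocalEquation b₁ 𝔟 x t) ∧
    FiniteDimensional k (R.sections b₁ 𝔟) ∧
    ∀ τ : R.Trivialization b₁ 𝔟,
      Module.finrank k τ.code = Module.finrank k (R.sections b₁ 𝔟) ∧
      (((n : ℤ) - b₂ * (q + 1) - (a - b₂) * b₁).toNat : ℕ∞) ≤ RuledCode.minDist τ.code := by
  subst hq ha hn h𝔟
  have hcard := RuledCode.RuledSurface.card_rationalPoint (R := R)
  have hU : R.HasUniformizers := RuledCode.RuledSurface.SelfIntersection.hasUniformizers hRe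
  have hb₁ : b₁ ≤ Nat.card k + 1 := by
    -- With `n = a(q + 1)` the designed distance factors as `(a - b₂)(q + 1 - b₁)`.
    have h : 0 < ((Nat.card (RuledCode.RationalPoint R.strC) : ℤ) - RuledCode.degree R.strC 𝔟) *
        (Nat.card k + 1 - b₁) := by
      rw [hcard] at hpos
      push_cast at hpos
      linarith
    have := (pos_iff_pos_of_mul_pos h).mp (by linarith)
    linarith
  -- A nonzero section has a codeword of weight at least the designed distance, which is positive.
  have hinj (τ : R.Trivialization b₁ 𝔟) : Function.Injective τ.germMap := by
    rw [injective_iff_map_eq_zero]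
    intro f hf
    by_contra hf0
    have h := τ.le_encard_support hR hRe he hb₁ f hf0
    simp only [hf, Pi.zero_apply, ne_eq, not_true_eq_false, Set.ofPred_false, Set.encard_empty,
      nonpos_iff_eq_zero, Nat.cast_eq_zero] at h
    omega
  choose t ht using RuledCode.RuledSurface.exists_isLocalEquation hU b₁ 𝔟
  refine ⟨inferInstance, inferInstance, hcard, fun x => ⟨t x, ht x⟩, ?_, fun τ => ⟨?_, ?_⟩⟩
  -- Finite dimension needs no coherence theorem: evaluation embeds the sections into `k ^ n`.
  · let τ : R.Trivialization b₁ 𝔟 := ⟨fun P => t P.1, fun P => ht P.1⟩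
    exact Module.Finite.of_injective τ.germMap (hinj τ)
  · exact LinearMap.finrank_range_of_inj (hinj τ)
  -- By linearity the distance of two codewords is the weight of the codeword of `f - f'`; with no
  -- such pair the infimum is `⊤`.
  · refine le_iInf₂ fun c hc => le_iInf₂ fun c' hc' => le_iInf fun hne => ?_
    obtain ⟨f, rfl⟩ := hc
    obtain ⟨f', rfl⟩ := hc'
    have h := τ.le_encard_support hR hRe he hb₁ (f - f') (sub_ne_zero.mpr fun h => hne (by rw [h]))
    simpa only [map_sub, Pi.sub_apply, sub_ne_zero] using h
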